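/- Let $p=(p_k)_{k}$, indexed by the positive integers, satisfy $0<p_k<1$, let $q_k=1-p_k$, and let $\Omega=\{-1,+1\}^{\mathbb N}$ carry the product $\sigma$-algebra and the product measure $P=\bigotimes_k(p_k\delta_{+1}+q_k\delta_{-1})$. Let $X_k(\omega)=\omega_k$ and $Y_k=(X_k-p_k+q_k)/(2\sqrt{p_kq_k})$. For a square-summable symmetric function $f$ on $\mathbb N^n$ that vanishes on diagonals (that is, at all points with two equal coordinates) put $J_n(f)=\sum_{(i_1,\dots,i_n)\in\mathbb N^n}f(i_1,\dots,i_n)Y_{i_1}\cdots Y_{i_n}$ (convergence in $L^2(\Omega)$). Every $F\in L^2(\Omega)$ has a unique chaos representation $F=\mathbb E[F]+\sum_{n\ge1}J_n(f_n)$ in $L^2(\Omega)$ with such kernels $f_n$. We write $F\in\mathrm{dom}(D)$ if $\sum_{n\ge1}n\,n!\,\|f_n\|^2_{\ell^2(\mathbb N^n)}<\infty$. The discrete gradient $DF=(D_kF)_k$ is $D_kF(\omega)=\sqrt{p_kq_k}\,(F(\omega^k_+)-F(\omega^k_-))$, where $\omega^k_\pm$ is $\omega$ with its $k$-th coordinate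 replaced by $\pm1$, and $L^{-1}(F-\mathbb E[F])=-\sum_{n\ge1}\frac1nJ_n(f_n)$. Let $F\in\mathrm{dom}(D)$ take values in $\mathbb N_0=\{0,1,2,\dots\}$ and let $\mathrm{Po}(\lambda)$ be a Poisson random variable with mean $\lambda>0$. Then the series $\langle DF,-DL^{-1}(F-\mathbb E[F])\rangle_{\ell^2(\mathbb N)}=\sum_kD_kF\cdot(-D_kL^{-1}(F-\mathbb E[F]))$ converges absolutely almost surely, its sum is integrable, and the total variation distance $d_{TV}(F,\mathrm{Po}(\lambda))=\sup_{A\subseteq\mathbb N_0}|P(F\in A)-P(\mathrm{Po}(\lambda)\in A)|$ satisfies $$\begin{aligned}d_{TV}(F,\mathrm{Po}(\lambda))\le{}&\Big(1\wedge\sqrt{\tfrac{2}{e\lambda}}\Big)\big|\lambda-\mathbb E[F]\big|+\frac{1-e^{-\lambda}}{\lambda}\,\mathbb E\Big[\big|\lambda-\langle DF,-DL^{-1}(F-\mathbb E[F])\rangle_{\ell^2(\mathbb N)}\big|\Big]\\&+\frac{1-e^{-\lambda}}{\lambda}\,\mathbb E\Big[\sum_{k}\frac{1}{\sqrt{p_kq_k}}\,D_kF\,\big(D_kF+\sqrt{p_kq_k}\,X_k\big)\,\big|-D_kL^{-1}(F-\mathbb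 E[F])\big|\Big],\end{aligned}$$ where the summands in the last expectation are non-negative, so that this expectation is defined in $[0,\infty]$. -/

import Mathlib

open MeasureTheory ProbabilityTheory
open scoped NNReal ENNReal Nat

namespace RademacherPoisson

noncomputable section

/-- The sample space `{-1, +1}^ℕ`; the group of units `ℤˣ` is the two-point set `{-1, +1}`
with its discrete `σ`-algebra, and the product carries the product `σ`-algebra. -/
abbrev Omega : Type := ℕ → ℤˣ

/-- The two-point law `a δ_{+1} + (1 - a) δ_{-1}`. -/
def coin (a : Set.Ioo (0 : ℝ) 1) : Measure ℤˣ :=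
  ENNReal.ofReal (a : ℝ) • Measure.dirac 1 + ENNReal.ofReal (1 - (a : ℝ)) • Measure.dirac (-1)

instance (a : Set.Ioo (0 : ℝ) 1) : IsProbabilityMeasure (coin a) := by
  constructor
  have h := a.2
  simp only [coin, Measure.add_apply, Measure.smul_apply, measure_univ, smul_eq_mul, mul_one]
  rw [← ENNReal.ofReal_add h.1.le (by linarith [h.2])]
  simp

/-- The product law of the Rademacher sequence with success probabilities `p`. -/
def P (p : ℕ → Set.Ioo (0 : ℝ) 1) : Measure Omega :=
  Measure.infinitePi fun k => coin (p k)

instance (p : ℕ → Set.Ioo (0 : ℝ) 1) : IsProbabilityMeasure (P p) := by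
  unfold P; infer_instance

/-- The Rademacher sequence `X_k(ω) = ω_k`, as a real random variable. -/
def X (k : ℕ) (ω : Omega) : ℝ := ((ω k : ℤ) : ℝ)

/-- The number `√(p_k q_k)`, where `q_k = 1 - p_k`. -/
def sd (p : ℕ → Set.Ioo (0 : ℝ) 1) (k : ℕ) : ℝ := √((p k : ℝ) * (1 - (p k : ℝ)))

/-- The standardized sequence `Y_k = (X_k - p_k + q_k) / (2 √(p_k q_k))`. -/
def Y (p : ℕ → Set.Ioo (0 : ℝ) 1) (k : ℕ) (ω : Omega) : ℝ :=
  (X k ω - (p k : ℝ) + (1 - (p k : ℝ))) / (2 * sd p k)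

lemma measurable_X (k : ℕ) : Measurable (X k) := by
  have h : Measurable fun u : ℤˣ => ((u : ℤ) : ℝ) :=
    (Measurable.of_discrete (f := fun z : ℤ => (z : ℝ))).comp (comap_measurable _)
  exact h.comp (measurable_pi_apply k)

lemma measurable_Y (p : ℕ → Set.Ioo (0 : ℝ) 1) (k : ℕ) : Measurable (Y p k) :=
  (((measurable_X k).sub_const _).add_const _).div_const _

lemma abs_X (k : ℕ) (ω : Omega) : |X k ω| = 1 := by
  unfold X
  rcases Int.units_eq_one_or (ω k) with h | h <;> simp [h]

lemma memLp_prod_Y (p : ℕ → Set.Ioo (0 : ℝ) 1) {n : ℕ} (i : Fin n → ℕ) :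
    MemLp (fun ω => ∏ j, Y p (i j) ω) 2 (P p) := by
  have hY : ∀ k, ∃ C, ∀ ω, |Y p k ω| ≤ C := fun k => by
    refine ⟨(1 + |(p k : ℝ)| + |1 - (p k : ℝ)|) / |2 * sd p k|, fun ω => ?_⟩
    rw [Y, abs_div]
    gcongr
    calc _ ≤ |X k ω - (p k : ℝ)| + |1 - (p k : ℝ)| := abs_add_le _ _
      _ ≤ |X k ω| + |(p k : ℝ)| + |1 - (p k : ℝ)| := by gcongr; exact abs_sub _ _
      _ = _ := by rw [abs_X]
  choose C hC using hY
  refine MemLp.of_bound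
    (Finset.measurable_prod _ fun j _ => measurable_Y p (i j)).aestronglyMeasurable
    (∏ j, C (i j)) (Filter.Eventually.of_forall fun ω => ?_)
  rw [Real.norm_eq_abs, Finset.abs_prod]
  exact Finset.prod_le_prod (fun _ _ => abs_nonneg _) fun j _ => hC _ ω

/-- The product `Y_{i_1} ⋯ Y_{i_n}` as an element of `L²(Ω)`. -/
def prodY (p : ℕ → Set.Ioo (0 : ℝ) 1) {n : ℕ} (i : Fin n → ℕ) : Lp ℝ 2 (P p) :=
  (memLp_prod_Y p i).toLp _

/-- The space `ℓ₀²(ℕ)^{∘n}` of square-summable symmetric kernels vanishing on diagonals; for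
`n = 0` these are the constants. -/
structure IsKernel {n : ℕ} (f : (Fin n → ℕ) → ℝ) : Prop where
  summable_sq : Summable fun i => f i ^ 2
  symm : ∀ (σ : Equiv.Perm (Fin n)) (i : Fin n → ℕ), f (i ∘ σ) = f i
  diag : ∀ i : Fin n → ℕ, ¬ Function.Injective i → f i = 0

/-- The discrete multiple stochastic integral
`J_n(f) = ∑_{i ∈ ℕⁿ} f(i_1, …, i_n) Y_{i_1} ⋯ Y_{i_n}`, the series being taken in `L²(Ω)`. -/
def J (p : ℕ → Set.Ioo (0 : ℝ) 1) (n : ℕ) (f : (Fin n → ℕ) → ℝ) : Lp ℝ 2 (P p) :=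
  ∑' i : Fin n → ℕ, f i • prodY p i

/-- `F ∈ L²(Ω)` has the chaos representation `F = E[F] + ∑_{n ≥ 1} J_n(f_n)`, with
convergence in `L²(Ω)`. The summand with `n = 0` is `J_0(E[F]) = E[F]`. -/
structure IsChaosRep (p : ℕ → Set.Ioo (0 : ℝ) 1) (F : Omega → ℝ)
    (f : (n : ℕ) → (Fin n → ℕ) → ℝ) : Prop where
  memLp : MemLp F 2 (P p)
  kernel : ∀ n, IsKernel (f n)
  zero : f 0 = fun _ => ∫ ω, F ω ∂(P p)
  hasSum : HasSum (fun n => J p n (f n)) (memLp.toLp F)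

/-- `F ∈ dom(D)`: `F` is square-integrable and its chaos kernels satisfy
`∑_{n ≥ 1} n · n! ‖f_n‖² < ∞`. -/
def DomD (p : ℕ → Set.Ioo (0 : ℝ) 1) (F : Omega → ℝ) : Prop :=
  ∃ f, IsChaosRep p F f ∧
    Summable fun n : ℕ => (n : ℝ) * (n ! : ℝ) * ∑' i : Fin n → ℕ, f n i ^ 2

/-- The discrete gradient `D_k F(ω) = √(p_k q_k) (F(ω_+^k) - F(ω_-^k))`. -/
def D (p : ℕ → Set.Ioo (0 : ℝ) 1) (F : Omega → ℝ) (k : ℕ) (ω : Omega) : ℝ :=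
  sd p k * (F (Function.update ω k 1) - F (Function.update ω k (-1)))

open Classical in
/-- The pseudo-inverse of the discrete Ornstein-Uhlenbeck operator,
`L⁻¹ G = -∑_{n ≥ 1} (1/n) J_n(f_n)` for a centered `G ∈ L²(Ω)` with chaos kernels `f_n`
(these are determined by `G`). -/
def LInv (p : ℕ → Set.Ioo (0 : ℝ) 1) (G : Omega → ℝ) : Lp ℝ 2 (P p) :=
  if h : ∃ f, IsChaosRep p G f then
    -∑' n : ℕ, (1 / ((n : ℝ) + 1)) • J p (n + 1) (h.choose (n + 1))
  else 0

/-- The sequence `-D_k L⁻¹(F - E[F])`. -/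
def negDLInv (p : ℕ → Set.Ioo (0 : ℝ) 1) (F : Omega → ℝ) (k : ℕ) (ω : Omega) : ℝ :=
  -D p (LInv p fun ω' => F ω' - ∫ ω'', F ω'' ∂(P p)) k ω

/-- The total variation distance `sup_{A ⊆ ℕ} |μ(A) - ν(A)|` of two laws on `ℕ = {0, 1, 2, …}`. -/
def dTV (μ ν : Measure ℕ) : ℝ := ⨆ A : Set ℕ, |μ.real A - ν.real A|

end

end RademacherPoisson

open RademacherPoisson

/-!
The proof combines the Chen–Stein equation with integration by parts on the Rademacher space.

For a set `A` of natural numbers let `g` solve `l g(k + 1) - k g(k) = 1_A(k) - Po(l)(A)`. Then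
`P(F ∈ A) - Po(l)(A) = E[l g(F + 1) - F g(F)]`, which splits into `(l - E F) E g(F)`,
`l E[g(F + 1) - g(F)]` and `-E[(F - E F) g(F)]`. By integration by parts
(`IsChaosRep.hasSum_integral_neg_D_LInv_mul_D`) the last expectation is
`E[∑ₖ (-Dₖ L⁻¹(F - E F)) Dₖ g(F)]`, and by the approximate chain rule (`abs_D_comp_sub_le`)
`Dₖ g(F)` is `(g(F + 1) - g(F)) Dₖ F` up to the remainder in the third term of the bound. It remains
to use the bounds on `g` and on its differences (`exists_stein_solution`).

The bound on the differences is read off the explicit solution, in which the ratios of Poisson tails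
and weights are monotone. The supremum of `|g(k + 1)|` over all `A` is
`P(Z ≤ k) P(Z > k) / (l P(Z = k))` for `Z` Poisson with mean `l`. This is the integral over
`s ∈ [0, 1]` of the probability that `B + Z' = k`, where `B` is binomial with parameters `k`,
`1 - s` and `Z'` is an independent Poisson variable with mean `l s`
(`integral_deathLaw`); no such probability exceeds `1` or `1 / √(2 e l s)`, by
`poissonWeight_le`, which yields `min 1 √(2 / (e l))`.

On the Rademacher side everything is expressed in the orthonormal system of the products
`∏_{k ∈ S} Yₖ`, `S` a finite set. In this system `Dₖ` removes `k` from `S`, because `Dₖ` is dual to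
multiplication by `Yₖ` (`integral_Y_mul`), and `L⁻¹` divides by `-|S|`
(`IsChaosRep.LInv_spec`). Since `S` has `|S|` elements, summing Parseval's identity for the
gradients over `k` restores the factor `|S|`. Completeness of the system is not needed: a functional
with a chaos representation lies in its closed span.
-/

namespace RademacherPoisson

noncomputable section

/-! ### Poisson weights and tails -/

/-- The weight `e^{-l} l^j / j!` of the Poisson law with mean `l` at `j`. -/
def poissonWeight (l : ℝ) (j : ℕ) : ℝ := Real.exp (-l) * l ^ j / (j ! : ℝ)

/-- The Poisson distribution function `∑_{j ≤ k} e^{-l} l^j / j!`. -/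
def poissonCDF (l : ℝ) (k : ℕ) : ℝ := ∑ j ∈ Finset.range (k + 1), poissonWeight l j

lemma poissonWeight_pos {l : ℝ} (hl : 0 < l) (j : ℕ) : 0 < poissonWeight l j := by
  unfold poissonWeight; positivity

lemma poissonWeight_nonneg {l : ℝ} (hl : 0 ≤ l) (j : ℕ) : 0 ≤ poissonWeight l j := by
  unfold poissonWeight; positivity

lemma poissonWeight_succ (l : ℝ) (j : ℕ) :
    ((j : ℝ) + 1) * poissonWeight l (j + 1) = l * poissonWeight l j := by
  unfold poissonWeight
  rw [Nat.factorial_succ]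
  push_cast
  have : (j ! : ℝ) ≠ 0 := by positivity
  field_simp
  ring

lemma hasSum_poissonWeight {l : ℝ} (hl : 0 ≤ l) : HasSum (poissonWeight l) 1 :=
  hasSum_one_poissonMeasure ⟨l, hl⟩

lemma poissonMeasure_real_eq {l : ℝ≥0} {A : Set ℕ} {α : ℝ}
    (h : HasSum (A.indicator (poissonWeight l)) α) : (poissonMeasure l).real A = α := by
  rw [← integral_indicator_one (MeasurableSet.of_discrete (s := A)), integral_poissonMeasure,
    ← h.tsum_eq]
  refine tsum_congr fun n => ?_
  by_cases hn : n ∈ A <;> simp [hn, poissonWeight]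

lemma poissonCDF_succ (l : ℝ) (k : ℕ) :
    poissonCDF l (k + 1) = poissonCDF l k + poissonWeight l (k + 1) :=
  Finset.sum_range_succ _ _

lemma poissonCDF_nonneg {l : ℝ} (hl : 0 ≤ l) (k : ℕ) : 0 ≤ poissonCDF l k :=
  Finset.sum_nonneg fun j _ => poissonWeight_nonneg hl j

lemma poissonCDF_le_one {l : ℝ} (hl : 0 ≤ l) (k : ℕ) : poissonCDF l k ≤ 1 :=
  sum_le_hasSum _ (fun j _ => poissonWeight_nonneg hl j) (hasSum_poissonWeight hl)

/-- Left tails: `l P(Z ≤ k) ≤ (k + 1) P(1 ≤ Z ≤ k + 1)` for `Z` Poisson with mean `l`. -/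
lemma mul_poissonCDF_le {l : ℝ} (hl : 0 ≤ l) (k : ℕ) :
    l * poissonCDF l k ≤ (k + 1) * (poissonCDF l (k + 1) - Real.exp (-l)) := by
  have h0 : poissonWeight l 0 = Real.exp (-l) := by simp [poissonWeight]
  rw [poissonCDF, poissonCDF, Finset.sum_range_succ' _ (k + 1), h0, add_sub_cancel_right,
    Finset.mul_sum, Finset.mul_sum]
  refine Finset.sum_le_sum fun j hj => ?_
  rw [← poissonWeight_succ]
  have : (j : ℝ) ≤ k := by exact_mod_cast Nat.lt_succ_iff.mp (Finset.mem_range.mp hj)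
  gcongr
  exact poissonWeight_nonneg hl _

/-- Right tails: `(k + 1) P(Z > k + 1) ≤ l P(Z > k)` for `Z` Poisson with mean `l`. -/
lemma mul_one_sub_poissonCDF_le {l : ℝ} (hl : 0 ≤ l) (k : ℕ) :
    (k + 1) * (1 - poissonCDF l (k + 1)) ≤ l * (1 - poissonCDF l k) := by
  have hs := hasSum_poissonWeight hl
  have tail (m : ℕ) : HasSum (fun j => poissonWeight l (j + m)) (1 - ∑ j ∈ Finset.range m,
      poissonWeight l j) := (hasSum_nat_add_iff' m).mpr hs
  refine hasSum_le (fun j => ?_) ((tail (k + 2)).mul_left ((k : ℝ) + 1))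
    ((tail (k + 1)).mul_left l)
  have h := poissonWeight_succ l (j + (k + 1))
  rw [← h]
  push_cast
  have := poissonWeight_nonneg hl (j + (k + 1) + 1)
  have hj : (0 : ℝ) ≤ j := by positivity
  rw [show j + (k + 2) = j + (k + 1) + 1 by ring]
  nlinarith

/-! ### The largest Poisson weight -/

/-- The difference of the two sides is antitone, its derivative being `log (1 - u²)`. -/
lemma entropy_diff_le {u : ℝ} (h0 : 0 ≤ u) (h1 : u < 1) :
    (1 + u) * Real.log (1 + u) - (1 - u) * Real.log (1 - u) ≤ 2 * u := by
  let ent : ℝ → ℝ := fun u => (1 + u) * Real.log (1 + u) - (1 - u) * Real.log (1 - u) - 2 * u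
  have hd : ∀ x ∈ Set.Ico (0 : ℝ) 1,
      HasDerivAt ent (Real.log (1 + x) + Real.log (1 - x)) x := by
    intro x hx
    have a : HasDerivAt (fun u : ℝ => 1 + u) 1 x := (hasDerivAt_id x).const_add 1
    have b : HasDerivAt (fun u : ℝ => 1 - u) (-1) x := (hasDerivAt_id x).const_sub 1
    have ha : 1 + x ≠ 0 := by linarith [hx.1]
    have hb : 1 - x ≠ 0 := by linarith [hx.2]
    convert! (((a.mul (a.log ha)).sub (b.mul (b.log hb))).sub
      ((hasDerivAt_id x).const_mul 2)) using 1
    field_simp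
    ring
  have hanti : AntitoneOn ent (Set.Ico 0 1) := by
    refine antitoneOn_of_deriv_nonpos (convex_Ico 0 1)
      (fun x hx => (hd x hx).continuousAt.continuousWithinAt)
      (fun x hx => (hd x (interior_subset hx)).differentiableAt.differentiableWithinAt) ?_
    intro x hx
    have hx := interior_subset hx
    rw [(hd x hx).deriv, ← Real.log_mul (by linarith [hx.1]) (by linarith [hx.2])]
    refine Real.log_nonpos ?_ ?_ <;> nlinarith [hx.1, hx.2]
  have := hanti ⟨le_rfl, one_pos⟩ ⟨h0, h1⟩ h0
  simp only [ent] at this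
  norm_num at this
  linarith

/-- The sequence `log ((j + 1/2)^{j + 1/2} e^{-j} / j!)` attains its maximum at `j = 0`. -/
lemma log_factorial_ge (j : ℕ) :
    ((j : ℝ) + 1 / 2) * Real.log (j + 1 / 2) - j - Real.log (j ! : ℝ) ≤
      1 / 2 * Real.log (1 / 2) := by
  induction j with
  | zero => simp
  | succ j ih =>
    refine le_trans ?_ ih
    have hx : (0 : ℝ) < (j : ℝ) + 1 := by positivity
    have hu : 1 / (2 * ((j : ℝ) + 1)) < 1 := by
      rw [div_lt_one (by positivity)]; linarith [(Nat.cast_nonneg j : (0 : ℝ) ≤ j)]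
    have key := entropy_diff_le (u := 1 / (2 * ((j : ℝ) + 1))) (by positivity) hu
    have e1 : ((j : ℝ) + 1) * (1 + 1 / (2 * ((j : ℝ) + 1))) = (j : ℝ) + 1 + 1 / 2 := by
      field_simp
    have e2 : ((j : ℝ) + 1) * (1 - 1 / (2 * ((j : ℝ) + 1))) = (j : ℝ) + 1 / 2 := by
      field_simp; ring
    have l1 : Real.log ((j : ℝ) + 1 + 1 / 2) =
        Real.log ((j : ℝ) + 1) + Real.log (1 + 1 / (2 * ((j : ℝ) + 1))) := by
      rw [← e1, Real.log_mul hx.ne' (by positivity)]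
    have l2 : Real.log ((j : ℝ) + 1 / 2) =
        Real.log ((j : ℝ) + 1) + Real.log (1 - 1 / (2 * ((j : ℝ) + 1))) := by
      rw [← e2, Real.log_mul hx.ne' (by linarith)]
    have hk := mul_le_mul_of_nonneg_left key hx.le
    have e3 : ((j : ℝ) + 1) * (2 * (1 / (2 * ((j : ℝ) + 1)))) = 1 := by field_simp
    rw [e3, mul_sub, ← mul_assoc, ← mul_assoc, e1, e2] at hk
    rw [Nat.factorial_succ]
    push_cast
    rw [Real.log_mul hx.ne' (by positivity), l1, l2]
    nlinarith

/-- Every Poisson weight is at most `1 / √(2 e μ)`. -/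
lemma poissonWeight_le {μ : ℝ} (hμ : 0 < μ) (j : ℕ) :
    poissonWeight μ j ≤ √(1 / (2 * Real.exp 1 * μ)) := by
  have hpos : (0 : ℝ) < 1 / (2 * Real.exp 1 * μ) := by positivity
  rw [← Real.log_le_log_iff (poissonWeight_pos hμ j) (by positivity), Real.log_sqrt hpos.le,
    poissonWeight, Real.log_div (by positivity) (by positivity),
    Real.log_mul (by positivity) (by positivity), Real.log_exp, Real.log_pow, Real.log_div
    (by positivity) (by positivity), Real.log_mul (by positivity) hμ.ne', Real.log_mul
    (by positivity) (by positivity), Real.log_exp, Real.log_one]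
  have h1 := log_factorial_ge j
  rw [show (1 / 2 : ℝ) * Real.log (1 / 2) = - (1 / 2 * Real.log 2) by
    rw [one_div, Real.log_inv]; ring] at h1
  have ha : (0 : ℝ) < (j : ℝ) + 1 / 2 := by positivity
  -- the weight is maximal in `μ` at `μ = j + 1/2` after multiplication by `√μ`
  have h2 : Real.log μ ≤ Real.log (j + 1 / 2) + (μ / (j + 1 / 2) - 1) := by
    have := Real.log_le_sub_one_of_pos (div_pos hμ ha)
    rw [Real.log_div hμ.ne' ha.ne'] at this
    linarith
  have h3 := mul_le_mul_of_nonneg_left h2 ha.le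
  have h4 : ((j : ℝ) + 1 / 2) * (μ / (j + 1 / 2) - 1) = μ - (j + 1 / 2) := by
    field_simp
  rw [mul_add, h4] at h3
  linarith

/-! ### The immigration-death process -/

/-- The probability that `B + Z = j` for independent `B` binomial with parameters `m`, `1 - s`
and `Z` Poisson with mean `l s`. This is the law at time `-log (1 - s)` of the immigration-death
process with stationary mean `l` started at `m`. -/
def deathLaw (l : ℝ) : ℕ → ℕ → ℝ → ℝ
  | 0, j, s => poissonWeight (l * s) j
  | m + 1, 0, s => s * deathLaw l m 0 s
  | m + 1, j + 1, s => s * deathLaw l m (j + 1) s + (1 - s) * deathLaw l m j s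

/-- The distribution function of `deathLaw`. -/
def deathCDF (l : ℝ) (m k : ℕ) (s : ℝ) : ℝ := ∑ j ∈ Finset.range (k + 1), deathLaw l m j s

/-- Adding the independent binomial variable does not increase the largest weight. -/
lemma deathLaw_le {l s C : ℝ} (h0 : 0 ≤ s) (h1 : s ≤ 1) (hC : 0 ≤ C)
    (h : ∀ j, poissonWeight (l * s) j ≤ C) (m j : ℕ) : deathLaw l m j s ≤ C := by
  have h2 : 0 ≤ 1 - s := by linarith
  induction m generalizing j with
  | zero => exact h j
  | succ m ih =>
    cases j with
    | zero => simp only [deathLaw]; nlinarith [mul_le_mul_of_nonneg_left (ih 0) h0]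
    | succ j =>
      simp only [deathLaw]
      nlinarith [mul_le_mul_of_nonneg_left (ih (j + 1)) h0, mul_le_mul_of_nonneg_left (ih j) h2]

lemma continuous_deathLaw (l : ℝ) (m j : ℕ) : Continuous (deathLaw l m j) := by
  induction m generalizing j with
  | zero =>
    change Continuous fun s => poissonWeight (l * s) j
    unfold poissonWeight
    fun_prop
  | succ m ih =>
    cases j with
    | zero => exact continuous_id.mul (ih 0)
    | succ j =>
      exact (continuous_id.mul (ih _)).add ((continuous_const.sub continuous_id).mul (ih _))

lemma deathCDF_zero_right (l : ℝ) (m : ℕ) (s : ℝ) : deathCDF l m 0 s = deathLaw l m 0 s := by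
  simp [deathCDF]

lemma deathCDF_succ_right (l : ℝ) (m k : ℕ) (s : ℝ) :
    deathCDF l m (k + 1) s = deathCDF l m k s + deathLaw l m (k + 1) s :=
  Finset.sum_range_succ _ _

lemma deathCDF_succ_left (l : ℝ) (m k : ℕ) (s : ℝ) :
    deathCDF l (m + 1) k s = deathCDF l m k s - (1 - s) * deathLaw l m k s := by
  induction k with
  | zero => simp only [deathCDF_zero_right, deathLaw]; ring
  | succ k ih => rw [deathCDF_succ_right, ih, deathCDF_succ_right]; simp only [deathLaw]; ring

lemma hasDerivAt_poissonWeight_zero (l s : ℝ) :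
    HasDerivAt (fun s => poissonWeight (l * s) 0) (-l * poissonWeight (l * s) 0) s := by
  have : HasDerivAt (fun s => Real.exp (-(l * s))) (Real.exp (-(l * s)) * -(l * 1)) s :=
    (((hasDerivAt_id s).const_mul l).neg).exp
  convert! this using 1
  · ext; simp [poissonWeight]
  · simp [poissonWeight]; ring

lemma hasDerivAt_poissonWeight_succ (l s : ℝ) (j : ℕ) :
    HasDerivAt (fun s => poissonWeight (l * s) (j + 1))
      (l * (poissonWeight (l * s) j - poissonWeight (l * s) (j + 1))) s := by
  have h1 : HasDerivAt (fun s => Real.exp (-(l * s))) (Real.exp (-(l * s)) * -(l * 1)) s :=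
    (((hasDerivAt_id s).const_mul l).neg).exp
  have h2 : HasDerivAt (fun s => (l * s) ^ (j + 1)) (((j + 1 : ℕ) : ℝ) * (l * s) ^ j * (l * 1)) s :=
    ((hasDerivAt_id s).const_mul l).pow (j + 1)
  convert! (h1.mul h2).div_const ((j + 1)! : ℝ) using 1
  unfold poissonWeight
  rw [Nat.factorial_succ]
  push_cast
  have : (j ! : ℝ) ≠ 0 := by positivity
  field_simp
  ring

/-- The value `deathLaw l m (j - 1)`, read as zero for `j = 0`. -/
def deathLawPred (l : ℝ) (m : ℕ) : ℕ → ℝ → ℝ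
  | 0, _ => 0
  | j + 1, s => deathLaw l m j s

lemma deathLaw_succ_left (l : ℝ) (m j : ℕ) (s : ℝ) :
    deathLaw l (m + 1) j s = s * deathLaw l m j s + (1 - s) * deathLawPred l m j s := by
  cases j <;> simp [deathLaw, deathLawPred]

/-- The derivative of the law in the time parameter, the effects of immigration and of death. The
death term is absent when there are no initial individuals. -/
lemma hasDerivAt_deathLaw (l : ℝ) (j : ℕ) (s : ℝ) :
    HasDerivAt (deathLaw l 0 j) (l * (deathLawPred l 0 j s - deathLaw l 0 j s)) s ∧
    ∀ m, HasDerivAt (deathLaw l (m + 1) j)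
      (l * (deathLawPred l (m + 1) j s - deathLaw l (m + 1) j s)
        - (m + 1) * (deathLawPred l m j s - deathLaw l m j s)) s := by
  have base (j : ℕ) :
      HasDerivAt (deathLaw l 0 j) (l * (deathLawPred l 0 j s - deathLaw l 0 j s)) s := by
    cases j with
    | zero =>
      convert! hasDerivAt_poissonWeight_zero l s using 1
      simp [deathLawPred, deathLaw]
    | succ j => exact hasDerivAt_poissonWeight_succ l s j
  have hid : HasDerivAt (fun s : ℝ => s) 1 s := hasDerivAt_id s
  have hsub : HasDerivAt (fun s : ℝ => 1 - s) (-1) s := hid.const_sub 1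
  refine ⟨base j, fun m => ?_⟩
  induction m generalizing j with
  | zero =>
    cases j with
    | zero =>
      convert! hid.mul (base 0) using 1
      simp only [deathLawPred, deathLaw]; push_cast; ring
    | succ j =>
      convert! (hid.mul (base (j + 1))).add (hsub.mul (base j)) using 1
      simp only [deathLawPred, deathLaw_succ_left l 0 _ s]; push_cast; ring
  | succ m ih =>
    cases j with
    | zero =>
      convert! hid.mul (ih 0) using 1
      simp only [deathLawPred, deathLaw]; push_cast; ring
    | succ j =>
      convert! (hid.mul (ih (j + 1))).add (hsub.mul (ih j)) using 1
      simp only [deathLawPred, deathLaw_succ_left l (m + 1) _ s,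
        deathLaw_succ_left l m _ s]
      push_cast; ring

lemma hasDerivAt_deathCDF_zero (l : ℝ) (k : ℕ) (s : ℝ) :
    HasDerivAt (deathCDF l 0 k) (-l * deathLaw l 0 k s) s := by
  induction k with
  | zero =>
    convert! (hasDerivAt_deathLaw l 0 s).1 using 1
    · ext; simp [deathCDF]
    · simp [deathLawPred]
  | succ k ih =>
    convert! ih.add (hasDerivAt_deathLaw l (k + 1) s).1 using 1
    · ext; exact deathCDF_succ_right ..
    · simp only [deathLawPred]; ring

lemma hasDerivAt_deathCDF_succ (l : ℝ) (m k : ℕ) (s : ℝ) :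
    HasDerivAt (deathCDF l (m + 1) k)
      (-l * deathLaw l (m + 1) k s + (m + 1) * deathLaw l m k s) s := by
  induction k with
  | zero =>
    convert! (hasDerivAt_deathLaw l 0 s).2 m using 1
    · ext; simp [deathCDF]
    · simp only [deathLawPred]; ring
  | succ k ih =>
    convert! ih.add ((hasDerivAt_deathLaw l (k + 1) s).2 m) using 1
    · ext; exact deathCDF_succ_right ..
    · simp only [deathLawPred]; ring

lemma deathCDF_at_one (l : ℝ) (m k : ℕ) : deathCDF l m k 1 = poissonCDF l k := by
  induction m with
  | zero => simp [deathCDF, poissonCDF, deathLaw]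
  | succ m ih => rw [deathCDF_succ_left, ih]; simp

lemma deathCDF_at_zero (l : ℝ) {m k : ℕ} (h : m ≤ k) : deathCDF l m k 0 = 1 := by
  have law (m j : ℕ) : deathLaw l m j 0 = if j = m then 1 else 0 := by
    induction m generalizing j with
    | zero => cases j <;> simp [deathLaw, poissonWeight]
    | succ m ih => cases j <;> simp [deathLaw, ih]
  simp only [deathCDF, law]
  rw [Finset.sum_ite_eq' , if_pos (Finset.mem_range.mpr (by omega))]

/-- The expected time the immigration-death process started at `m ≤ k` spends at `k`, with time
weighted by `e^{-t}`. -/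
lemma integral_deathLaw (l : ℝ) {m k : ℕ} (h : m ≤ k) :
    l * poissonWeight l m * ∫ s in (0 : ℝ)..1, deathLaw l m k s =
      (1 - poissonCDF l k) * poissonCDF l m := by
  have hi (m : ℕ) : IntervalIntegrable (deathLaw l m k) volume 0 1 :=
    (continuous_deathLaw l m k).intervalIntegrable 0 1
  induction m with
  | zero =>
    have key := intervalIntegral.integral_eq_sub_of_hasDerivAt
      (fun s _ => hasDerivAt_deathCDF_zero l k s) ((hi 0).const_mul (-l))
    rw [deathCDF_at_one, deathCDF_at_zero l h, intervalIntegral.integral_const_mul] at key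
    simp only [poissonCDF, zero_add, Finset.sum_range_one]
    simp only [poissonCDF] at key
    linear_combination -(poissonWeight l 0) * key
  | succ m ih =>
    have key := intervalIntegral.integral_eq_sub_of_hasDerivAt
      (fun s _ => hasDerivAt_deathCDF_succ l m k s)
      (((hi (m + 1)).const_mul (-l)).add ((hi m).const_mul ((m : ℝ) + 1)))
    rw [deathCDF_at_one, deathCDF_at_zero l h, intervalIntegral.integral_add
      ((hi (m + 1)).const_mul (-l)) ((hi m).const_mul ((m : ℝ) + 1)),
      intervalIntegral.integral_const_mul, intervalIntegral.integral_const_mul] at key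
    have ih := ih (by omega)
    have hw := poissonWeight_succ l m
    rw [poissonCDF_succ]
    linear_combination ih - (poissonWeight l (m + 1)) * key +
      (∫ s in (0 : ℝ)..1, deathLaw l m k s) * hw

/-- The bound on the largest value of the solutions of the Stein equation. -/
lemma poissonCDF_mul_one_sub_le {l : ℝ} (hl : 0 < l) (k : ℕ) :
    poissonCDF l k * (1 - poissonCDF l k) ≤
      min 1 √(2 / (Real.exp 1 * l)) * (l * poissonWeight l k) := by
  have hw := poissonWeight_pos hl k
  rw [mul_comm (poissonCDF l k), ← integral_deathLaw l le_rfl, mul_comm]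
  refine mul_le_mul_of_nonneg_right ?_ (by positivity)
  have hi : IntervalIntegrable (deathLaw l k k) volume 0 1 :=
    (continuous_deathLaw l k k).intervalIntegrable 0 1
  refine le_min ?_ ?_
  · have : ∫ s in (0 : ℝ)..1, deathLaw l k k s ≤ ∫ _ in (0 : ℝ)..1, (1 : ℝ) := by
      refine intervalIntegral.integral_mono_on zero_le_one hi (by simp) fun s hs => ?_
      refine deathLaw_le hs.1 hs.2 zero_le_one (fun j => ?_) k k
      have h0 : 0 ≤ l * s := mul_nonneg hl.le hs.1
      exact le_hasSum (hasSum_poissonWeight h0) j fun i _ => poissonWeight_nonneg h0 i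
    simpa using this
  · have hint : IntervalIntegrable (fun s : ℝ => √(1 / (2 * Real.exp 1 * l)) * s ^ (-(1 / 2) : ℝ))
        volume 0 1 :=
      (intervalIntegral.intervalIntegrable_rpow' (by norm_num)).const_mul _
    have : ∫ s in (0 : ℝ)..1, deathLaw l k k s ≤
        ∫ s in (0 : ℝ)..1, √(1 / (2 * Real.exp 1 * l)) * s ^ (-(1 / 2) : ℝ) := by
      refine intervalIntegral.integral_mono_on_of_le_Ioo zero_le_one hi hint fun s hs => ?_
      refine deathLaw_le hs.1.le hs.2.le (by have := hs.1; positivity) (fun j => ?_) k k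
      refine (poissonWeight_le (mul_pos hl hs.1) j).trans_eq ?_
      rw [Real.rpow_neg hs.1.le, ← Real.sqrt_eq_rpow, ← Real.sqrt_inv,
        ← Real.sqrt_mul (by positivity)]
      congr 1
      have := hs.1.ne'
      field_simp
    refine this.trans_eq ?_
    rw [intervalIntegral.integral_const_mul, integral_rpow (Or.inl (by norm_num)),
      Real.one_rpow, Real.zero_rpow (by norm_num)]
    rw [show ((1 : ℝ) - 0) / (-(1 / 2) + 1) = √4 by
      rw [show (4 : ℝ) = 2 ^ 2 by norm_num, Real.sqrt_sq zero_le_two]; norm_num,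
      ← Real.sqrt_mul (by positivity)]
    congr 1
    field_simp
    norm_num

/-! ### Solutions of the Chen–Stein equation -/

/-- **Solutions of the Chen–Stein equation** and the two bounds ("magic factors") on them. The
value at zero does not enter the equation, and is set so that the first difference vanishes. -/
theorem exists_stein_solution {l : ℝ} (hl : 0 < l) (A : Set ℕ) :
    ∃ (g : ℕ → ℝ) (α : ℝ), HasSum (A.indicator (poissonWeight l)) α ∧
      (∀ k : ℕ, l * g (k + 1) - k * g k = A.indicator 1 k - α) ∧
      (∀ k, |g k| ≤ min 1 √(2 / (Real.exp 1 * l))) ∧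
      ∀ k, |g (k + 1) - g k| ≤ (1 - Real.exp (-l)) / l := by
  have hw := poissonWeight_pos hl
  have hπ := hasSum_poissonWeight hl.le
  -- the solution is constructed for a general set, since the complement is needed as well
  let mass (A : Set ℕ) (k : ℕ) : ℝ := ∑ j ∈ Finset.range (k + 1), A.indicator (poissonWeight l) j
  let α (A : Set ℕ) : ℝ := ∑' j, A.indicator (poissonWeight l) j
  -- the truncated subtraction makes `sol A 0` equal to `sol A 1`
  let sol (A : Set ℕ) : ℕ → ℝ := fun k =>
    (mass A (k - 1) - α A * poissonCDF l (k - 1)) / (l * poissonWeight l (k - 1))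
  have hsum (A : Set ℕ) : HasSum (A.indicator (poissonWeight l)) (α A) :=
    (hπ.summable.indicator A).hasSum
  have hnn (A : Set ℕ) (j : ℕ) : 0 ≤ A.indicator (poissonWeight l) j :=
    Set.indicator_nonneg (fun j _ => (hw j).le) j
  have hcompl (A : Set ℕ) (j : ℕ) : Aᶜ.indicator (poissonWeight l) j =
      poissonWeight l j - A.indicator (poissonWeight l) j := by
    rw [Set.indicator_compl]; rfl
  have hmassc (A : Set ℕ) (k : ℕ) : mass Aᶜ k = poissonCDF l k - mass A k := by
    simp only [mass, poissonCDF, hcompl, Finset.sum_sub_distrib]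
  have hαc (A : Set ℕ) : α Aᶜ = 1 - α A := by
    refine (hsum Aᶜ).unique ?_
    simp only [funext (hcompl A)]
    exact hπ.sub (hsum A)
  have hsolc (A : Set ℕ) (k : ℕ) : sol Aᶜ k = -sol A k := by
    simp only [sol, hmassc, hαc]; ring
  have hmass0 (A : Set ℕ) (k : ℕ) : 0 ≤ mass A k := Finset.sum_nonneg fun j _ => hnn A j
  have hmassα (A : Set ℕ) (k : ℕ) : mass A k ≤ α A :=
    sum_le_hasSum _ (fun j _ => hnn A j) (hsum A)
  have hmass_succ (A : Set ℕ) (k : ℕ) :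
      mass A (k + 1) = mass A k + A.indicator (poissonWeight l) (k + 1) :=
    Finset.sum_range_succ _ _
  have hind (A : Set ℕ) (k : ℕ) :
      A.indicator (poissonWeight l) k = A.indicator 1 k * poissonWeight l k := by
    by_cases h : k ∈ A <;> simp [h]
  have bound (A : Set ℕ) (k : ℕ) : sol A k ≤ min 1 √(2 / (Real.exp 1 * l)) := by
    simp only [sol]
    rw [div_le_iff₀ (mul_pos hl (hw _))]
    refine le_trans ?_ (poissonCDF_mul_one_sub_le hl (k - 1))
    have h1 := poissonCDF_nonneg hl.le (k - 1)
    have h2 := poissonCDF_le_one hl.le (k - 1)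
    have h3 := hmassα A (k - 1)
    have h4 := hmass0 Aᶜ (k - 1)
    rw [hmassc] at h4
    nlinarith [mul_nonneg h1 (sub_nonneg.2 h3), mul_nonneg (sub_nonneg.2 h2) h4]
  have diff (A : Set ℕ) (k : ℕ) :
      sol A (k + 1 + 1) - sol A (k + 1) ≤ (1 - Real.exp (-l)) / l := by
    simp only [sol, Nat.add_sub_cancel]
    have hW : poissonWeight l (k + 1) = l * poissonWeight l k / (k + 1) := by
      rw [eq_div_iff (by positivity), mul_comm, poissonWeight_succ]
    have hW0 := hw k
    have hk : (0 : ℝ) < (k : ℝ) + 1 := by positivity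
    set U := poissonCDF l k
    set V := poissonCDF l (k + 1) with hV
    set u := mass A k
    set t := A.indicator (poissonWeight l) (k + 1) with ht
    set a := α A
    have hVU : V = U + poissonWeight l (k + 1) := poissonCDF_succ l k
    have ht0 : 0 ≤ t := hnn A _
    have ht1 : t ≤ poissonWeight l (k + 1) := Set.indicator_le_self' (fun j _ => (hw j).le) _
    have hu0 : 0 ≤ u := hmass0 A k
    have hv0 : 0 ≤ a - u - t := by
      have := hmassα A (k + 1)
      rw [hmass_succ] at this
      linarith
    have hL := mul_poissonCDF_le hl.le k
    have hR := mul_one_sub_poissonCDF_le hl.le k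
    have hexp := Real.exp_pos (-l)
    rw [← hV] at hL hR
    rw [hmass_succ A k, ← ht]
    set ρ := l / ((k : ℝ) + 1) with hρ
    have hWρ : poissonWeight l (k + 1) = ρ * poissonWeight l k := by rw [hW, hρ]; ring
    have hρ0 : 0 < ρ := by positivity
    have hL' : ρ * U ≤ V - Real.exp (-l) := by
      rw [hρ, div_mul_eq_mul_div, div_le_iff₀ hk]; linarith
    have hR' : 1 - V ≤ ρ * (1 - U) := by
      rw [hρ, div_mul_eq_mul_div, le_div_iff₀ hk]; linarith
    have he1 : Real.exp (-l) ≤ 1 := Real.exp_le_one_iff.mpr (by linarith)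
    have e1 : (u + t - a * V) / (l * poissonWeight l (k + 1)) - (u - a * U) /
        (l * poissonWeight l k) =
        ((u + t - a * V) - ρ * (u - a * U)) / (l * poissonWeight l (k + 1)) := by
      rw [hWρ]; field_simp
    rw [e1, div_le_div_iff₀ (mul_pos hl (hw _)) hl]
    have e2 : (u + t - a * V) - ρ * (u - a * U) =
        t * (1 - V + ρ * U) - u * (ρ * (1 - U) - (1 - V)) - (a - u - t) * (V - ρ * U) := by ring
    have e3 : (u + t - a * V) - ρ * (u - a * U) ≤
        (1 - Real.exp (-l)) * poissonWeight l (k + 1) := by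
      rw [e2]
      have f1 := mul_nonneg hu0 (sub_nonneg.2 hR')
      have f2 := mul_nonneg hv0 (show 0 ≤ V - ρ * U by linarith)
      have f3 : t * (1 - V + ρ * U) ≤ t * (1 - Real.exp (-l)) := by gcongr; linarith
      have f4 : t * (1 - Real.exp (-l)) ≤ poissonWeight l (k + 1) * (1 - Real.exp (-l)) :=
        mul_le_mul_of_nonneg_right ht1 (by linarith)
      linarith
    nlinarith [mul_le_mul_of_nonneg_left e3 hl.le]
  refine ⟨sol A, α A, hsum A, fun k => ?_, fun k => ?_, fun k => ?_⟩
  · cases k with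
    | zero =>
      simp only [sol, mass, hind]
      have := hw 0
      simp [poissonCDF]
      field_simp
    | succ k =>
      simp only [sol, Nat.add_sub_cancel]
      rw [hmass_succ, hind, poissonCDF_succ]
      have h1 := hw k
      have h2 := hw (k + 1)
      have h3 := poissonWeight_succ l k
      push_cast
      rw [← h3]
      field_simp
      ring
  · refine abs_le'.mpr ⟨bound A k, ?_⟩
    rw [← hsolc]
    exact bound Aᶜ k
  · cases k with
    | zero =>
      have : Real.exp (-l) ≤ 1 := Real.exp_le_one_iff.mpr (by linarith)
      change |sol A 1 - sol A 1| ≤ _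
      rw [sub_self, abs_zero]
      exact div_nonneg (by linarith) hl.le
    | succ k =>
      refine abs_le'.mpr ⟨diff A k, ?_⟩
      have := diff Aᶜ k
      rw [hsolc, hsolc] at this
      linarith

/-! ### Resampling one coordinate -/

variable {p : ℕ → Set.Ioo (0 : ℝ) 1}

lemma sd_pos (p : ℕ → Set.Ioo (0 : ℝ) 1) (k : ℕ) : 0 < sd p k :=
  Real.sqrt_pos.mpr (mul_pos (p k).2.1 (by linarith [(p k).2.2]))

lemma measurable_update_const (k : ℕ) (x : ℤˣ) :
    Measurable fun ω : Omega => Function.update ω k x :=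
  measurable_pi_lambda _ fun i => by
    by_cases h : i = k
    · subst h; simp
    · simpa [Function.update_of_ne h] using measurable_pi_apply i

/-- Resampling the `k`-th coordinate does not change the law of the Rademacher sequence. -/
lemma P_eq_resample (p : ℕ → Set.Ioo (0 : ℝ) 1) (k : ℕ) :
    P p = ENNReal.ofReal (p k : ℝ) • (P p).map (fun ω => Function.update ω k 1) +
      ENNReal.ofReal (1 - (p k : ℝ)) • (P p).map (fun ω => Function.update ω k (-1)) := by
  symm
  unfold P
  refine Measure.eq_infinitePi _ fun s t ht => ?_
  have key (x : ℤˣ) : (Measure.infinitePi fun k => coin (p k)).map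
      (fun ω => Function.update ω k x) (Set.pi s t) =
      (if k ∈ s then (t k).indicator 1 x else 1) *
        ∏ i ∈ s.erase k, coin (p i) (t i) := by
    rw [Measure.map_apply (measurable_update_const k x)
      (MeasurableSet.pi s.countable_toSet fun i _ => ht i)]
    by_cases hx : k ∈ s → x ∈ t k
    · have : (fun ω : Omega => Function.update ω k x) ⁻¹' Set.pi s t =
          Set.pi (s.erase k : Finset ℕ) t := by
        ext ω
        simp only [Set.mem_preimage, Set.mem_pi, Finset.mem_coe, Finset.mem_erase]
        constructor
        · intro h i hi
          have := h i hi.2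
          rwa [Function.update_of_ne hi.1] at this
        · intro h i hi
          by_cases hik : i = k
          · subst hik; simpa using hx hi
          · rw [Function.update_of_ne hik]; exact h i ⟨hik, hi⟩
      rw [this, Measure.infinitePi_pi _ (fun i _ => ht i)]
      by_cases hk : k ∈ s <;> simp [hk, hx]
    · push Not at hx
      have : (fun ω : Omega => Function.update ω k x) ⁻¹' Set.pi s t = ∅ := by
        ext ω
        simp only [Set.mem_preimage, Set.mem_pi, Set.mem_empty_iff_false, iff_false]
        intro h
        have := h k hx.1
        rw [Function.update_self] at this
        exact hx.2 this
      simp [this, hx]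
  rw [Measure.add_apply, Measure.smul_apply, Measure.smul_apply, key, key, smul_eq_mul,
    smul_eq_mul, ← mul_assoc, ← mul_assoc, ← add_mul]
  by_cases hk : k ∈ s
  · rw [← Finset.mul_prod_erase s _ hk]
    simp [hk, coin, ht k]
  · have h := (p k).2
    rw [Finset.erase_eq_of_notMem hk]
    simp only [hk, if_false, mul_one]
    rw [← ENNReal.ofReal_add h.1.le (by linarith [h.2])]
    simp

/-- The two one-coordinate perturbations have laws dominated by a multiple of `P`. -/
lemma map_update_le (p : ℕ → Set.Ioo (0 : ℝ) 1) (k : ℕ) (x : ℤˣ) :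
    ∃ c : ℝ≥0∞, c ≠ ∞ ∧ (P p).map (fun ω => Function.update ω k x) ≤ c • P p := by
  have aux {a : ℝ} (ha : 0 < a) {μ : Measure Omega} (h : ENNReal.ofReal a • μ ≤ P p) :
      μ ≤ (ENNReal.ofReal a)⁻¹ • P p := by
    have h0 : ENNReal.ofReal a ≠ 0 := by simpa using ha
    calc μ = (ENNReal.ofReal a)⁻¹ • (ENNReal.ofReal a • μ) := by
          rw [smul_smul, ENNReal.inv_mul_cancel h0 ENNReal.ofReal_ne_top, one_smul]
      _ ≤ _ := by gcongr
  have fin {a : ℝ} (ha : 0 < a) : (ENNReal.ofReal a)⁻¹ ≠ ∞ := by simpa using ha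
  have h := (p k).2
  rcases Int.units_eq_one_or x with rfl | rfl
  · refine ⟨_, fin h.1, aux h.1 ?_⟩
    conv_rhs => rw [P_eq_resample p k]
    exact Measure.le_add_right le_rfl
  · refine ⟨_, fin (sub_pos.2 h.2), aux (sub_pos.2 h.2) ?_⟩
    conv_rhs => rw [P_eq_resample p k]
    exact Measure.le_add_left le_rfl

lemma memLp_update {u : Omega → ℝ} {r : ℝ≥0∞} (hu : MemLp u r (P p)) (k : ℕ) (x : ℤˣ) :
    MemLp (fun ω => u (Function.update ω k x)) r (P p) := by
  obtain ⟨c, hc, hle⟩ := map_update_le p k x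
  have h := hu.of_measure_le_smul hc hle
  exact (memLp_map_measure_iff h.aestronglyMeasurable
    (measurable_update_const k x).aemeasurable).mp h

lemma integral_resample {u : Omega → ℝ} (hu : Integrable u (P p)) (k : ℕ) :
    ∫ ω, u ω ∂(P p) = (p k : ℝ) * ∫ ω, u (Function.update ω k 1) ∂(P p) +
      (1 - (p k : ℝ)) * ∫ ω, u (Function.update ω k (-1)) ∂(P p) := by
  have hp := (p k).2
  have hmap (x : ℤˣ) : Integrable u ((P p).map (fun ω => Function.update ω k x)) := by
    obtain ⟨c, hc, hle⟩ := map_update_le p k x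
    exact (hu.smul_measure hc).mono_measure hle
  conv_lhs => rw [P_eq_resample p k]
  rw [integral_add_measure ((hmap 1).smul_measure ENNReal.ofReal_ne_top)
    ((hmap (-1)).smul_measure ENNReal.ofReal_ne_top), integral_smul_measure,
    integral_smul_measure,
    integral_map (measurable_update_const k _).aemeasurable (hmap _).aestronglyMeasurable,
    integral_map (measurable_update_const k _).aemeasurable (hmap _).aestronglyMeasurable,
    ENNReal.toReal_ofReal hp.1.le, ENNReal.toReal_ofReal (by linarith [hp.2])]
  rfl

lemma memLp_D {u : Omega → ℝ} {r : ℝ≥0∞} (hu : MemLp u r (P p)) (k : ℕ) :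
    MemLp (D p u k) r (P p) :=
  ((memLp_update hu k 1).sub (memLp_update hu k (-1))).const_mul _

lemma Y_update_one (p : ℕ → Set.Ioo (0 : ℝ) 1) (k : ℕ) (ω : Omega) :
    (p k : ℝ) * Y p k (Function.update ω k 1) = sd p k := by
  have h := sd_pos p k
  have h2 : sd p k * sd p k = (p k : ℝ) * (1 - p k) :=
    Real.mul_self_sqrt (mul_nonneg (p k).2.1.le (by linarith [(p k).2.2]))
  simp only [Y, X, Function.update_self, Units.val_one, Int.cast_one]
  rw [← mul_div_assoc, div_eq_iff (by positivity)]
  linarith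

lemma Y_update_neg_one (p : ℕ → Set.Ioo (0 : ℝ) 1) (k : ℕ) (ω : Omega) :
    (1 - (p k : ℝ)) * Y p k (Function.update ω k (-1)) = -sd p k := by
  have h := sd_pos p k
  have h2 : sd p k * sd p k = (p k : ℝ) * (1 - p k) :=
    Real.mul_self_sqrt (mul_nonneg (p k).2.1.le (by linarith [(p k).2.2]))
  simp only [Y, X, Function.update_self, Units.val_neg, Units.val_one, Int.cast_neg, Int.cast_one]
  rw [← mul_div_assoc, div_eq_iff (by positivity)]
  linarith

lemma Y_update_of_ne {j k : ℕ} (h : j ≠ k) (x : ℤˣ) (ω : Omega) :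
    Y p j (Function.update ω k x) = Y p j ω := by
  simp only [Y, X, Function.update_of_ne h]

lemma bounded_Y (p : ℕ → Set.Ioo (0 : ℝ) 1) (k : ℕ) : ∃ C, ∀ ω, ‖Y p k ω‖ ≤ C := by
  refine ⟨(1 + |(p k : ℝ)| + |1 - (p k : ℝ)|) / |2 * sd p k|, fun ω => ?_⟩
  rw [Real.norm_eq_abs, Y, abs_div]
  gcongr
  calc _ ≤ |X k ω - (p k : ℝ)| + |1 - (p k : ℝ)| := abs_add_le _ _
    _ ≤ |X k ω| + |(p k : ℝ)| + |1 - (p k : ℝ)| := by gcongr; exact abs_sub _ _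
    _ = _ := by rw [abs_X]

lemma memLp_Y_mul {u : Omega → ℝ} {r : ℝ≥0∞} (hu : MemLp u r (P p)) (k : ℕ) :
    MemLp (fun ω => Y p k ω * u ω) r (P p) := by
  obtain ⟨C, hC⟩ := bounded_Y p k
  exact MemLp.of_le_mul (c := C) hu
    ((measurable_Y p k).aestronglyMeasurable.mul hu.aestronglyMeasurable)
    (Filter.Eventually.of_forall fun ω => by
      rw [norm_mul]; exact mul_le_mul_of_nonneg_right (hC ω) (norm_nonneg _))

/-- One-coordinate integration by parts. -/
lemma integral_Y_mul {u : Omega → ℝ} (hu : Integrable u (P p)) (k : ℕ) :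
    ∫ ω, Y p k ω * u ω ∂(P p) = ∫ ω, D p u k ω ∂(P p) := by
  have hu' := memLp_one_iff_integrable.mpr hu
  rw [integral_resample (memLp_one_iff_integrable.mp (memLp_Y_mul hu' k)) k,
    ← integral_const_mul, ← integral_const_mul]
  simp only [← mul_assoc, Y_update_one, Y_update_neg_one, D, mul_sub]
  rw [integral_sub ((memLp_one_iff_integrable.mp (memLp_update hu' k 1)).const_mul _)
    ((memLp_one_iff_integrable.mp (memLp_update hu' k (-1))).const_mul _)]
  simp only [neg_mul, integral_neg]
  ring

/-- The gradient in direction `k` does not depend on the `k`-th coordinate. -/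
lemma D_update (u : Omega → ℝ) (k : ℕ) (x : ℤˣ) (ω : Omega) :
    D p u k (Function.update ω k x) = D p u k ω := by
  simp [D]

/-- A factor that does not depend on the `k`-th coordinate can be pulled out of `D_k`. -/
lemma D_mul_of_update {u v : Omega → ℝ} {k : ℕ}
    (hv : ∀ x ω, v (Function.update ω k x) = v ω) (ω : Omega) :
    D p (fun ω => u ω * v ω) k ω = D p u k ω * v ω := by
  simp only [D, hv]; ring

/-- `E[D_k u D_k v] = E[Y_k u D_k v]`. -/
lemma integral_D_mul_D {u v : Omega → ℝ} (hu : MemLp u 2 (P p)) (hv : MemLp v 2 (P p)) (k : ℕ) :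
    ∫ ω, D p u k ω * D p v k ω ∂(P p) = ∫ ω, u ω * (Y p k ω * D p v k ω) ∂(P p) := by
  have h := integral_Y_mul (hu.integrable_mul (memLp_D hv k)) k
  simp only [Pi.mul_apply] at h
  rw [show D p (u * D p v k) k = fun ω => D p u k ω * D p v k ω from
    funext (D_mul_of_update (D_update v k))] at h
  rw [← h]
  congr 1; ext ω; ring

/-! ### Walsh products -/

/-- The product `∏_{k ∈ S} Y_k`, an element of the Walsh-type orthonormal system of `L²(Ω)`. -/
def walsh (p : ℕ → Set.Ioo (0 : ℝ) 1) (S : Finset ℕ) (ω : Omega) : ℝ := ∏ k ∈ S, Y p k ω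

lemma walsh_update {S : Finset ℕ} {k : ℕ} (h : k ∉ S) (x : ℤˣ) (ω : Omega) :
    walsh p S (Function.update ω k x) = walsh p S ω :=
  Finset.prod_congr rfl fun _ hj => Y_update_of_ne (ne_of_mem_of_not_mem hj h) x ω

lemma walsh_insert {S : Finset ℕ} {k : ℕ} (h : k ∉ S) (ω : Omega) :
    walsh p (insert k S) ω = Y p k ω * walsh p S ω := Finset.prod_insert h

lemma memLp_walsh (p : ℕ → Set.Ioo (0 : ℝ) 1) (S : Finset ℕ) (r : ℝ≥0∞) :
    MemLp (walsh p S) r (P p) := by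
  induction S using Finset.induction_on with
  | empty => exact (memLp_const (1 : ℝ)).congr_norm (by
      unfold walsh; simp; exact aestronglyMeasurable_const) (by simp [walsh])
  | insert k S hk ih =>
    rw [funext (walsh_insert hk)]
    exact memLp_Y_mul ih k

lemma D_walsh_of_notMem {S : Finset ℕ} {k : ℕ} (h : k ∉ S) (ω : Omega) :
    D p (walsh p S) k ω = 0 := by
  simp [D, walsh_update h]

lemma D_Y (k : ℕ) (ω : Omega) : D p (Y p k) k ω = 1 := by
  have h := sd_pos p k
  simp only [D, Y, X, Function.update_self, Units.val_neg, Units.val_one, Int.cast_neg,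
    Int.cast_one]
  field_simp
  ring

lemma D_walsh_insert {S : Finset ℕ} {k : ℕ} (h : k ∉ S) (ω : Omega) :
    D p (walsh p (insert k S)) k ω = walsh p S ω := by
  rw [funext (walsh_insert h), D_mul_of_update (walsh_update h), D_Y, one_mul]

lemma integral_walsh_mul_walsh (p : ℕ → Set.Ioo (0 : ℝ) 1) (S T : Finset ℕ) :
    ∫ ω, walsh p S ω * walsh p T ω ∂(P p) = if S = T then 1 else 0 := by
  have hint (S T : Finset ℕ) : Integrable (fun ω => walsh p S ω * walsh p T ω) (P p) :=
    (memLp_walsh p S 2).integrable_mul (memLp_walsh p T 2)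
  -- an index in exactly one of the two sets makes the expectation vanish
  have off {S T : Finset ℕ} {k : ℕ} (hS : k ∈ S) (hT : k ∉ T) :
      ∫ ω, walsh p S ω * walsh p T ω ∂(P p) = 0 := by
    have hk := Finset.notMem_erase k S
    rw [← Finset.insert_erase hS]
    simp only [walsh_insert hk, mul_assoc]
    rw [integral_Y_mul (hint _ _)]
    simp [D, walsh_update hk, walsh_update hT]
  by_cases h : S = T
  · subst h
    rw [if_pos rfl]
    induction S using Finset.induction_on with
    | empty => simp [walsh]
    | insert k S hk ih =>
      rw [← ih]
      have := integral_Y_mul (hint (insert k S) S) k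
      simp only [D_mul_of_update (walsh_update hk), D_walsh_insert hk] at this
      rw [← this]
      congr 1; ext ω
      rw [walsh_insert hk]; ring
  · rw [if_neg h]
    obtain ⟨k, hk⟩ : ∃ k, ¬ (k ∈ S ↔ k ∈ T) := by
      by_contra hcon; push Not at hcon; exact h (Finset.ext hcon)
    by_cases hS : k ∈ S
    · exact off hS fun hT => hk ⟨fun _ => hT, fun _ => hS⟩
    · have hT : k ∈ T := by tauto
      simp only [mul_comm (walsh p S _)]
      exact off hT hS

/-- The gradient lowers Walsh coefficients. -/
lemma integral_walsh_mul_Y_mul_D {v : Omega → ℝ} (hv : MemLp v 2 (P p)) (S : Finset ℕ) (k : ℕ) :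
    ∫ ω, walsh p S ω * (Y p k ω * D p v k ω) ∂(P p) =
      if k ∈ S then ∫ ω, walsh p S ω * v ω ∂(P p) else 0 := by
  rw [← integral_D_mul_D (memLp_walsh p S 2) hv]
  by_cases h : k ∈ S
  · have hk := Finset.notMem_erase k S
    rw [if_pos h, ← Finset.insert_erase h]
    simp only [D_walsh_insert hk, walsh_insert hk, mul_assoc]
    have hint : Integrable (fun ω => walsh p (S.erase k) ω * v ω) (P p) :=
      (memLp_walsh p _ 2).integrable_mul hv
    rw [integral_Y_mul hint]
    congr 1; ext ω
    have := D_mul_of_update (p := p) (u := v) (walsh_update (p := p) hk) ω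
    simp only [mul_comm (v _)] at this
    rw [this, mul_comm]
  · simp [h, D_walsh_of_notMem h]

/-! ### Walsh coefficients and chaoses in `L²(Ω)` -/

lemma inner_eq_zero_of_mem_closedSpan {E : Type*} [NormedAddCommGroup E] [InnerProductSpace ℝ E]
    {s : Set E} {x y : E} (hy : ∀ z ∈ s, inner ℝ y z = 0)
    (hx : x ∈ (Submodule.span ℝ s).topologicalClosure) : inner ℝ y x = 0 := by
  rw [← Submodule.mem_orthogonal_singleton_iff_inner_right]
  refine Submodule.topologicalClosure_minimal _ ?_ (Submodule.isClosed_orthogonal _) hx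
  rw [Submodule.span_le]
  intro z hz
  exact Submodule.mem_orthogonal_singleton_iff_inner_right.mpr (hy z hz)

/-- Parseval's identity for an orthonormal family that need not be total, provided one of the two
vectors lies in its closed span. -/
lemma hasSum_inner_mul_inner_of_mem_closedSpan {ι E : Type*} [NormedAddCommGroup E]
    [InnerProductSpace ℝ E] [CompleteSpace E] {e : ι → E} (he : Orthonormal ℝ e) {x : E}
    (hx : x ∈ (Submodule.span ℝ (Set.range e)).topologicalClosure) (y : E) :
    HasSum (fun i => inner ℝ (e i) x * inner ℝ (e i) y) (inner ℝ x y) := by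
  obtain ⟨w, b, hw, hb⟩ := he.toSubtypeRange.exists_hilbertBasis_extension
  let f : ι → w := fun i => ⟨e i, hw ⟨i, rfl⟩⟩
  have hf : Function.Injective f := fun i j h =>
    he.linearIndependent.injective (congrArg Subtype.val h)
  have hbf (i : ι) : b (f i) = e i := by rw [hb]
  have h := b.hasSum_inner_mul_inner x y
  rw [← hf.hasSum_iff] at h
  · refine h.congr_fun fun i => ?_
    simp only [Function.comp_apply, hbf]
    rw [real_inner_comm]
  · intro j hj
    rw [real_inner_comm, inner_eq_zero_of_mem_closedSpan _ hx, zero_mul]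
    rintro _ ⟨i, rfl⟩
    rw [← hbf i]
    exact b.orthonormal.2 fun h => hj ⟨i, h.symm⟩

lemma inner_toLp {Ω : Type*} [MeasurableSpace Ω] {μ : Measure Ω} {u v : Ω → ℝ}
    (hu : MemLp u 2 μ) (hv : MemLp v 2 μ) :
    inner ℝ (hu.toLp u) (hv.toLp v) = ∫ ω, u ω * v ω ∂μ := by
  rw [L2.inner_def]
  refine integral_congr_ae ?_
  filter_upwards [hu.coeFn_toLp, hv.coeFn_toLp] with ω h1 h2
  rw [h1, h2]
  simp [mul_comm]

/-- The class of `walsh p S` in `L²(Ω)`. -/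
def walshLp (p : ℕ → Set.Ioo (0 : ℝ) 1) (S : Finset ℕ) : Lp ℝ 2 (P p) :=
  (memLp_walsh p S 2).toLp _

lemma orthonormal_walshLp (p : ℕ → Set.Ioo (0 : ℝ) 1) : Orthonormal ℝ (walshLp p) := by
  rw [orthonormal_iff_ite]
  intro S T
  rw [walshLp, walshLp, inner_toLp, integral_walsh_mul_walsh]

/-- The closed span of all Walsh products. -/
def walshSpan (p : ℕ → Set.Ioo (0 : ℝ) 1) : Submodule ℝ (Lp ℝ 2 (P p)) :=
  (Submodule.span ℝ (Set.range (walshLp p))).topologicalClosure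

/-- The `n`-th Rademacher chaos, the closed span of the Walsh products of degree `n`. -/
def chaos (p : ℕ → Set.Ioo (0 : ℝ) 1) (n : ℕ) : Submodule ℝ (Lp ℝ 2 (P p)) :=
  (Submodule.span ℝ (walshLp p '' {S | S.card = n})).topologicalClosure

lemma chaos_le_walshSpan (p : ℕ → Set.Ioo (0 : ℝ) 1) (n : ℕ) : chaos p n ≤ walshSpan p :=
  Submodule.topologicalClosure_mono (Submodule.span_mono (Set.image_subset_range _ _))

lemma isClosed_chaos (p : ℕ → Set.Ioo (0 : ℝ) 1) (n : ℕ) :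
    IsClosed (chaos p n : Set (Lp ℝ 2 (P p))) := Submodule.isClosed_topologicalClosure _

lemma isClosed_walshSpan (p : ℕ → Set.Ioo (0 : ℝ) 1) :
    IsClosed (walshSpan p : Set (Lp ℝ 2 (P p))) := Submodule.isClosed_topologicalClosure _

lemma inner_walshLp_of_mem_chaos {n : ℕ} {x : Lp ℝ 2 (P p)} (hx : x ∈ chaos p n) {S : Finset ℕ}
    (hS : S.card ≠ n) : inner ℝ (walshLp p S) x = 0 := by
  refine inner_eq_zero_of_mem_closedSpan ?_ hx
  rintro _ ⟨T, hT, rfl⟩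
  exact (orthonormal_walshLp p).2 fun h => hS (h ▸ hT)

lemma orthogonalFamily_chaos (p : ℕ → Set.Ioo (0 : ℝ) 1) :
    OrthogonalFamily ℝ (fun n => chaos p n) fun n => (chaos p n).subtypeₗᵢ := by
  intro m n hmn x y
  refine inner_eq_zero_of_mem_closedSpan ?_ y.2
  rintro _ ⟨T, hT, rfl⟩
  rw [real_inner_comm]
  exact inner_walshLp_of_mem_chaos x.2 fun h => hmn (h.symm.trans hT)

lemma prodY_eq_walshLp {n : ℕ} {i : Fin n → ℕ} (hi : Function.Injective i) :
    prodY p i = walshLp p (Finset.univ.image i) := by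
  unfold prodY walshLp
  congr 1
  ext ω
  rw [walsh, Finset.prod_image hi.injOn]

lemma J_mem_chaos {n : ℕ} {f : (Fin n → ℕ) → ℝ} (hf : IsKernel f) : J p n f ∈ chaos p n := by
  refine tsum_mem (isClosed_chaos p n) fun i => ?_
  by_cases hi : Function.Injective i
  · refine Submodule.smul_mem _ _ (Submodule.le_topologicalClosure _ (Submodule.subset_span ?_))
    rw [prodY_eq_walshLp hi]
    exact ⟨_, by simp [Finset.card_image_of_injective _ hi], rfl⟩
  · rw [hf.diag i hi, zero_smul]
    exact Submodule.zero_mem _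

/-- The injective enumerations of subsets of `S` by `Fin n`. -/
def enumerations (n : ℕ) (S : Finset ℕ) : Finset (Fin n → ℕ) :=
  {i ∈ Fintype.piFinset fun _ : Fin n => S | Function.Injective i}

lemma image_of_mem_enumerations {n : ℕ} {S : Finset ℕ} (hS : S.card = n) {i : Fin n → ℕ}
    (hi : i ∈ enumerations n S) : Function.Injective i ∧ Finset.univ.image i = S := by
  rw [enumerations, Finset.mem_filter, Fintype.mem_piFinset] at hi
  refine ⟨hi.2, Finset.eq_of_subset_of_card_le ?_ ?_⟩
  · intro k hk
    obtain ⟨j, _, rfl⟩ := Finset.mem_image.mp hk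
    exact hi.1 j
  · rw [Finset.card_image_of_injective _ hi.2, hS, Finset.card_univ, Fintype.card_fin]

lemma card_enumerations_le {n : ℕ} {S : Finset ℕ} (hS : S.card = n) :
    (enumerations n S).card ≤ n ! := by
  have h : (Finset.univ : Finset (Fin n ↪ S)).card = n ! := by
    rw [Finset.card_univ, Fintype.card_embedding_eq, Fintype.card_coe, hS, Fintype.card_fin,
      Nat.descFactorial_self]
  rw [← h]
  refine Finset.card_le_card_of_surjOn (fun e j => (e j : ℕ)) fun i hi => ?_
  rw [Finset.mem_coe, enumerations, Finset.mem_filter, Fintype.mem_piFinset] at hi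
  exact ⟨⟨fun j => ⟨i j, hi.1 j⟩, fun j k h => hi.2 (congrArg Subtype.val h)⟩, by simp, rfl⟩

lemma inner_walshLp_J {n : ℕ} {f : (Fin n → ℕ) → ℝ} (hf : IsKernel f)
    (hs : Summable fun i => f i • prodY p i) {S : Finset ℕ} (hS : S.card = n) :
    inner ℝ (walshLp p S) (J p n f) = ∑ i ∈ enumerations n S, f i := by
  have h1 := (innerSL ℝ (walshLp p S)).hasSum hs.hasSum
  refine h1.unique ?_
  have h2 : ∑ i ∈ enumerations n S, f i =
      ∑ i ∈ enumerations n S, innerSL ℝ (walshLp p S) (f i • prodY p i) := by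
    refine Finset.sum_congr rfl fun i hi => ?_
    obtain ⟨hinj, him⟩ := image_of_mem_enumerations hS hi
    rw [prodY_eq_walshLp hinj, him, innerSL_apply_apply, inner_smul_right,
      orthonormal_iff_ite.mp (orthonormal_walshLp p), if_pos rfl, mul_one]
  rw [h2]
  refine hasSum_sum_of_ne_finset_zero fun i hi => ?_
  rw [innerSL_apply_apply, inner_smul_right]
  by_cases hinj : Function.Injective i
  · rw [prodY_eq_walshLp hinj, (orthonormal_walshLp p).2, mul_zero]
    rintro rfl
    refine hi ?_
    rw [enumerations, Finset.mem_filter, Fintype.mem_piFinset]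
    exact ⟨fun j => Finset.mem_image_of_mem _ (Finset.mem_univ j), hinj⟩
  · rw [hf.diag i hinj, zero_mul]

/-- The upper half of the isometry `‖J_n(f)‖² = n! ‖f‖²`, in terms of Walsh coefficients. -/
lemma sum_sq_inner_J_le {n : ℕ} {f : (Fin n → ℕ) → ℝ} (hf : IsKernel f)
    (s : Finset (Finset ℕ)) (hs : ∀ S ∈ s, S.card = n) :
    ∑ S ∈ s, inner ℝ (walshLp p S) (J p n f) ^ 2 ≤ (n ! : ℝ) * ∑' i, f i ^ 2 := by
  by_cases hsum : Summable fun i => f i • prodY p i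
  swap
  · have : J p n f = 0 := tsum_eq_zero_of_not_summable hsum
    simp only [this, inner_zero_right]
    have : 0 ≤ ∑' i, f i ^ 2 := tsum_nonneg fun i => sq_nonneg _
    simp only [ne_eq, OfNat.ofNat_ne_zero, not_false_eq_true, zero_pow, Finset.sum_const_zero]
    positivity
  calc ∑ S ∈ s, inner ℝ (walshLp p S) (J p n f) ^ 2
      ≤ ∑ S ∈ s, (n ! : ℝ) * ∑ i ∈ enumerations n S, f i ^ 2 := by
        refine Finset.sum_le_sum fun S hS => ?_
        rw [inner_walshLp_J hf hsum (hs S hS)]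
        refine sq_sum_le_card_mul_sum_sq.trans ?_
        refine mul_le_mul_of_nonneg_right ?_ (Finset.sum_nonneg fun i _ => sq_nonneg _)
        exact_mod_cast card_enumerations_le (hs S hS)
    _ = (n ! : ℝ) * ∑ i ∈ s.biUnion (enumerations n), f i ^ 2 := by
        rw [← Finset.mul_sum, Finset.sum_biUnion]
        intro S hS T hT hST
        rw [Function.onFun, Finset.disjoint_left]
        intro i hi hi'
        exact hST ((image_of_mem_enumerations (hs S hS) hi).2.symm.trans
          (image_of_mem_enumerations (hs T hT) hi').2)
    _ ≤ _ := by
        refine mul_le_mul_of_nonneg_left ?_ (by positivity)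
        exact hf.summable_sq.sum_le_tsum _ fun i _ => sq_nonneg _

namespace IsChaosRep

variable {u : Omega → ℝ} {f : (n : ℕ) → (Fin n → ℕ) → ℝ}

lemma inner_walshLp (h : IsChaosRep p u f) (S : Finset ℕ) :
    inner ℝ (walshLp p S) (h.memLp.toLp u) =
      inner ℝ (walshLp p S) (J p S.card (f S.card)) := by
  refine ((innerSL ℝ (walshLp p S)).hasSum h.hasSum).unique ?_
  refine hasSum_single S.card fun n hn => ?_
  exact inner_walshLp_of_mem_chaos (J_mem_chaos (h.kernel n)) hn.symm

lemma toLp_mem (h : IsChaosRep p u f) : h.memLp.toLp u ∈ walshSpan p := by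
  rw [← h.hasSum.tsum_eq]
  exact tsum_mem (isClosed_walshSpan p) fun n => chaos_le_walshSpan p n (J_mem_chaos (h.kernel n))

/-- The domain of `D` in terms of Walsh coefficients. -/
lemma summable_card_mul_sq (h : IsChaosRep p u f)
    (hD : Summable fun n : ℕ => (n : ℝ) * (n ! : ℝ) * ∑' i : Fin n → ℕ, f n i ^ 2) :
    Summable fun S : Finset ℕ =>
      (S.card : ℝ) * inner ℝ (walshLp p S) (h.memLp.toLp u) ^ 2 := by
  refine summable_of_sum_le (fun S => by positivity) (c := ∑' n : ℕ, (n : ℝ) * (n ! : ℝ) *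
    ∑' i : Fin n → ℕ, f n i ^ 2) fun s => ?_
  have hnn (n : ℕ) : 0 ≤ (n : ℝ) * (n ! : ℝ) * ∑' i : Fin n → ℕ, f n i ^ 2 := by
    have : 0 ≤ ∑' i : Fin n → ℕ, f n i ^ 2 := tsum_nonneg fun i => sq_nonneg _
    positivity
  refine le_trans ?_ (hD.sum_le_tsum (s.image Finset.card) fun n _ => hnn n)
  rw [← Finset.sum_fiberwise_of_maps_to (fun S hS => Finset.mem_image_of_mem Finset.card hS)]
  refine Finset.sum_le_sum fun n _ => ?_
  rw [mul_assoc]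
  refine le_trans (le_of_eq ?_) (mul_le_mul_of_nonneg_left
    (sum_sq_inner_J_le (p := p) (h.kernel n) {S ∈ s | S.card = n}
      fun S hS => (Finset.mem_filter.mp hS).2) (Nat.cast_nonneg n))
  rw [Finset.mul_sum]
  refine Finset.sum_congr rfl fun S hS => ?_
  obtain ⟨_, rfl⟩ := Finset.mem_filter.mp hS
  rw [h.inner_walshLp]

/-- Centering a functional only changes the kernel of order zero. -/
lemma centered (h : IsChaosRep p u f) :
    IsChaosRep p (fun ω => u ω - ∫ ω', u ω' ∂(P p)) (Function.update f 0 fun _ => 0) where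
  memLp := h.memLp.sub (memLp_const _)
  kernel n := by
    cases n with
    | zero =>
      rw [Function.update_self]
      exact ⟨by simp, fun _ _ => rfl, fun _ _ => rfl⟩
    | succ n => simpa using h.kernel (n + 1)
  zero := by
    rw [Function.update_self, integral_sub (h.memLp.integrable one_le_two) (integrable_const _)]
    simp
  hasSum := by
    have hJ : J p 0 (f 0) = (memLp_const (∫ ω', u ω' ∂(P p))).toLp _ := by
      rw [J, tsum_eq_single default fun i hi => absurd (Subsingleton.elim i default) hi, h.zero,
        prodY, ← MemLp.toLp_const_smul]
      congr 1
      ext ω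
      simp
    have h1 := h.hasSum.update 0 0
    rw [hJ, zero_sub, neg_add_eq_sub, ← MemLp.toLp_sub] at h1
    refine (h1.congr_fun fun n => ?_)
    cases n with
    | zero => simp [J]
    | succ n => simp

/-- The inverse of the Ornstein-Uhlenbeck operator is diagonal in the Walsh system. -/
lemma LInv_spec (h : IsChaosRep p u f) :
    LInv p u ∈ walshSpan p ∧ ∀ S, inner ℝ (walshLp p S) (LInv p u) =
      -(inner ℝ (walshLp p S) (h.memLp.toLp u) / (S.card : ℝ)) := by
  classical
  have hex : ∃ f, IsChaosRep p u f := ⟨f, h⟩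
  rw [LInv, dif_pos hex]
  have h' := hex.choose_spec
  set g := hex.choose
  have hJ (n : ℕ) := J_mem_chaos (p := p) (h'.kernel n)
  have hsq : Summable fun n => ‖J p n (g n)‖ ^ 2 :=
    ((orthogonalFamily_chaos p).summable_iff_norm_sq_summable
      fun n => ⟨J p n (g n), hJ n⟩).mp h'.hasSum.summable
  have hmem (n : ℕ) : (1 / ((n : ℝ) + 1)) • J p (n + 1) (g (n + 1)) ∈ chaos p (n + 1) :=
    Submodule.smul_mem _ _ (hJ (n + 1))
  have hsum : Summable fun n : ℕ => (1 / ((n : ℝ) + 1)) • J p (n + 1) (g (n + 1)) := by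
    refine (((orthogonalFamily_chaos p).comp (add_left_injective 1)).summable_iff_norm_sq_summable
      fun n => ⟨_, hmem n⟩).mpr ?_
    refine Summable.of_nonneg_of_le (fun n => sq_nonneg _) (fun n => ?_)
      ((summable_nat_add_iff 1).mpr hsq)
    refine pow_le_pow_left₀ (norm_nonneg _) ?_ 2
    change ‖(1 / ((n : ℝ) + 1)) • J p (n + 1) (g (n + 1))‖ ≤ _
    rw [norm_smul, Real.norm_of_nonneg (by positivity)]
    refine mul_le_of_le_one_left (norm_nonneg _) ?_
    rw [div_le_one (by positivity)]
    linarith [(Nat.cast_nonneg n : (0 : ℝ) ≤ n)]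
  refine ⟨Submodule.neg_mem _ (tsum_mem (isClosed_walshSpan p) fun n =>
    chaos_le_walshSpan p _ (hmem n)), fun S => ?_⟩
  rw [inner_neg_right, neg_inj]
  refine ((innerSL ℝ (walshLp p S)).hasSum hsum.hasSum).unique ?_
  rcases hS : S.card with _ | m
  · simp only [Nat.cast_zero, div_zero]
    convert! hasSum_zero with n
    exact inner_walshLp_of_mem_chaos (hmem n) (by omega)
  · have := h'.inner_walshLp S
    rw [this, hS]
    have e : inner ℝ (walshLp p S) (J p (m + 1) (g (m + 1))) / ((m + 1 : ℕ) : ℝ) =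
        innerSL ℝ (walshLp p S) ((1 / ((m : ℝ) + 1)) • J p (m + 1) (g (m + 1))) := by
      rw [innerSL_apply_apply, inner_smul_right]
      push_cast
      ring
    rw [e]
    exact hasSum_single m fun n hn => inner_walshLp_of_mem_chaos (hmem n) (by omega)

end IsChaosRep

/-- Parseval's identity for the gradients in one direction. -/
lemma hasSum_integral_D_mul_D {u v : Omega → ℝ} (hu : MemLp u 2 (P p))
    (hu' : hu.toLp u ∈ walshSpan p) (hv : MemLp v 2 (P p)) (k : ℕ) :
    HasSum (fun S : Finset ℕ => if k ∈ S then
        inner ℝ (walshLp p S) (hu.toLp u) * inner ℝ (walshLp p S) (hv.toLp v) else 0)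
      (∫ ω, D p u k ω * D p v k ω ∂(P p)) := by
  have hw := memLp_Y_mul (memLp_D hv k) k
  have h := hasSum_inner_mul_inner_of_mem_closedSpan (orthonormal_walshLp p) hu' (hw.toLp _)
  rw [inner_toLp, ← integral_D_mul_D hu hv] at h
  refine h.congr_fun fun S => ?_
  rw [walshLp, inner_toLp _ hw, integral_walsh_mul_Y_mul_D hv, inner_toLp _ hv]
  split_ifs <;> simp

/-- Summing over directions counts every index set as often as it has elements. -/
lemma hasSum_tsum_mem {c : Finset ℕ → ℝ} (hc : Summable fun S => (S.card : ℝ) * |c S|) {g : ℕ → ℝ}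
    (hg : ∀ k, HasSum (fun S => if k ∈ S then c S else 0) (g k)) :
    HasSum g (∑' S : Finset ℕ, (S.card : ℝ) * c S) := by
  have row (c : Finset ℕ → ℝ) (S : Finset ℕ) :
      HasSum (fun k => if k ∈ S then c S else 0) ((S.card : ℝ) * c S) := by
    have : ∑ k ∈ S, (if k ∈ S then c S else 0) = (S.card : ℝ) * c S := by
      rw [Finset.sum_congr rfl fun k hk => if_pos hk]; simp
    rw [← this]
    exact hasSum_sum_of_ne_finset_zero fun k hk => if_neg hk
  have hs : Summable fun x : Finset ℕ × ℕ => if x.2 ∈ x.1 then c x.1 else 0 := by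
    refine Summable.of_norm ?_
    rw [summable_prod_of_nonneg fun x => norm_nonneg _]
    have e (S : Finset ℕ) (k : ℕ) :
        ‖if k ∈ S then c S else 0‖ = if k ∈ S then |c S| else 0 := by
      split_ifs <;> simp
    simp only [e]
    exact ⟨fun S => (row (fun S => |c S|) S).summable,
      by simpa only [(row (fun S => |c S|) _).tsum_eq] using hc⟩
  have h1 := hs.hasSum.prod_fiberwise (row c)
  rw [h1.tsum_eq]
  exact ((Equiv.prodComm ℕ (Finset ℕ)).hasSum_iff.mpr hs.hasSum).prod_fiberwise hg

/-! ### Integration by parts for the discrete gradient -/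

namespace IsChaosRep

variable {u : Omega → ℝ} {f : (n : ℕ) → (Fin n → ℕ) → ℝ}

/-- On `dom(D)` the gradient is square-integrable with values in `ℓ²`. -/
lemma summable_integral_sq_D (h : IsChaosRep p u f)
    (hD : Summable fun n : ℕ => (n : ℝ) * (n ! : ℝ) * ∑' i : Fin n → ℕ, f n i ^ 2) :
    Summable fun k => ∫ ω, D p u k ω ^ 2 ∂(P p) := by
  have hc := h.summable_card_mul_sq hD
  refine (hasSum_tsum_mem (c := fun S => inner ℝ (walshLp p S) (h.memLp.toLp u) ^ 2)
    (by simpa using hc) fun k => ?_).summable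
  simpa only [sq] using hasSum_integral_D_mul_D h.memLp h.toLp_mem h.memLp k

lemma toLp_LInv_mem (h : IsChaosRep p u f) :
    (Lp.memLp (LInv p u)).toLp _ ∈ walshSpan p := by
  rw [Lp.toLp_coeFn]
  exact h.LInv_spec.1

/-- The gradient of `L⁻¹ u` is always square-integrable with values in `ℓ²`. -/
lemma summable_integral_sq_D_LInv (h : IsChaosRep p u f) :
    Summable fun k => ∫ ω, D p (LInv p u) k ω ^ 2 ∂(P p) := by
  have hb := (orthonormal_walshLp p).inner_products_summable (h.memLp.toLp u)
  refine (hasSum_tsum_mem (c := fun S => inner ℝ (walshLp p S) (LInv p u) ^ 2)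
    (Summable.of_nonneg_of_le (fun S => by positivity) (fun S => ?_) hb) fun k => ?_).summable
  · rw [h.LInv_spec.2, neg_sq, div_pow, Real.norm_eq_abs, sq_abs, abs_of_nonneg (by positivity)]
    rcases Nat.eq_zero_or_pos S.card with hS | hS
    · rw [hS]; simp only [Nat.cast_zero, zero_mul]; positivity
    · have h1 : (1 : ℝ) ≤ S.card := by exact_mod_cast hS
      rw [← mul_div_assoc, div_le_iff₀ (by positivity)]
      have := sq_nonneg (inner ℝ (walshLp p S) (h.memLp.toLp u))
      nlinarith [mul_nonneg this (show (0 : ℝ) ≤ S.card ^ 2 - S.card by nlinarith)]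
  · have := hasSum_integral_D_mul_D (Lp.memLp (LInv p u)) h.toLp_LInv_mem (Lp.memLp (LInv p u)) k
    simp only [Lp.toLp_coeFn] at this
    simpa only [sq] using this

/-- **Integration by parts**: `E[u v] = ∑_k E[-D_k L⁻¹ u · D_k v]` for centered `u` and arbitrary
`v` in `L²(Ω)`. -/
lemma hasSum_integral_neg_D_LInv_mul_D (h : IsChaosRep p u f) (h0 : ∫ ω, u ω ∂(P p) = 0)
    {v : Omega → ℝ} (hv : MemLp v 2 (P p)) :
    HasSum (fun k => ∫ ω, -D p (LInv p u) k ω * D p v k ω ∂(P p)) (∫ ω, u ω * v ω ∂(P p)) := by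
  set a : Finset ℕ → ℝ := fun S => inner ℝ (walshLp p S) (h.memLp.toLp u) with ha
  set b : Finset ℕ → ℝ := fun S => inner ℝ (walshLp p S) (hv.toLp v) with hb
  have hempty : a ∅ = 0 := by
    rw [ha]
    simp only [walshLp, inner_toLp]
    simpa [walsh] using h0
  have hcard (S : Finset ℕ) : (S.card : ℝ) * (a S / S.card * b S) = a S * b S := by
    rcases Nat.eq_zero_or_pos S.card with hS | hS
    · rw [Finset.card_eq_zero.mp hS, hempty]; simp
    · have : (S.card : ℝ) ≠ 0 := by exact_mod_cast hS.ne'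
      field_simp
  have hab : HasSum (fun S => a S * b S) (∫ ω, u ω * v ω ∂(P p)) := by
    rw [← inner_toLp h.memLp hv]
    exact hasSum_inner_mul_inner_of_mem_closedSpan (orthonormal_walshLp p) h.toLp_mem _
  have key := hasSum_tsum_mem (c := fun S => a S / S.card * b S)
    (g := fun k => ∫ ω, -D p (LInv p u) k ω * D p v k ω ∂(P p)) ?_ fun k => ?_
  · simp only [hcard] at key
    rwa [hab.tsum_eq] at key
  · have (S : Finset ℕ) : (S.card : ℝ) * |a S / S.card * b S| = |a S * b S| := by
      rw [← hcard, abs_mul (S.card : ℝ), Nat.abs_cast]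
    simp only [this]
    exact hab.summable.abs
  · have := (hasSum_integral_D_mul_D (Lp.memLp (LInv p u)) h.toLp_LInv_mem hv k).neg
    rw [← integral_neg] at this
    simp only [← neg_mul] at this
    refine this.congr_fun fun S => ?_
    simp only [Lp.toLp_coeFn, h.LInv_spec.2]
    split_ifs <;> simp [ha, hb]

end IsChaosRep

lemma summable_integral_norm_mul {Ω : Type*} [MeasurableSpace Ω] {μ : Measure Ω}
    {U V : ℕ → Ω → ℝ} (hU : ∀ k, MemLp (U k) 2 μ) (hV : ∀ k, MemLp (V k) 2 μ)
    (hU' : Summable fun k => ∫ ω, U k ω ^ 2 ∂μ) (hV' : Summable fun k => ∫ ω, V k ω ^ 2 ∂μ) :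
    Summable fun k => ∫ ω, ‖U k ω * V k ω‖ ∂μ := by
  refine Summable.of_nonneg_of_le (fun k => integral_nonneg fun ω => norm_nonneg _) (fun k => ?_)
    (hU'.add hV')
  rw [← integral_add (hU k).integrable_sq (hV k).integrable_sq]
  refine integral_mono ((hU k).integrable_mul (hV k)).norm
    ((hU k).integrable_sq.add (hV k).integrable_sq) fun ω => ?_
  dsimp only
  rw [Real.norm_eq_abs]
  refine abs_le.mpr ⟨?_, ?_⟩ <;> nlinarith [sq_nonneg (U k ω + V k ω), sq_nonneg (U k ω - V k ω),
    sq_nonneg (U k ω), sq_nonneg (V k ω)]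

lemma ae_summable_and_integrable_tsum {Ω : Type*} [MeasurableSpace Ω] {μ : Measure Ω}
    {f : ℕ → Ω → ℝ} (hf : ∀ k, Integrable (f k) μ)
    (hs : Summable fun k => ∫ ω, ‖f k ω‖ ∂μ) :
    (∀ᵐ ω ∂μ, Summable fun k => f k ω) ∧ Integrable (fun ω => ∑' k, f k ω) μ := by
  have hfin : ∫⁻ ω, ∑' k, ‖f k ω‖ₑ ∂μ ≠ ∞ := by
    rw [lintegral_tsum fun k => (hf k).aestronglyMeasurable.enorm]
    have (k : ℕ) : ∫⁻ ω, ‖f k ω‖ₑ ∂μ = ENNReal.ofReal (∫ ω, ‖f k ω‖ ∂μ) := by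
      rw [ofReal_integral_norm_eq_lintegral_enorm (hf k)]
    simp only [this]
    exact hs.tsum_ofReal_ne_top
  have hae : ∀ᵐ ω ∂μ, Summable fun k => f k ω := by
    filter_upwards [ae_lt_top' (AEMeasurable.tsum fun k =>
      (hf k).aestronglyMeasurable.enorm) hfin] with ω hω
    refine Summable.of_nnnorm ?_
    exact ENNReal.tsum_coe_ne_top_iff_summable.mp hω.ne
  refine ⟨hae, ?_, ?_⟩
  · refine aestronglyMeasurable_of_tendsto_ae Filter.atTop
      (f := fun n ω => ∑ k ∈ Finset.range n, f k ω)
      (fun n => Finset.aestronglyMeasurable_fun_sum _ fun k _ => (hf k).aestronglyMeasurable) ?_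
    filter_upwards [hae] with ω hω
    exact hω.hasSum.tendsto_sum_nat
  · exact (lintegral_mono fun ω => enorm_tsum_le_tsum_enorm).trans_lt hfin.lt_top

/-! ### Discrete Taylor expansion -/

lemma abs_add_sub_sub_mul_le {g : ℕ → ℝ} {M : ℝ} (hg : ∀ k, |g (k + 1) - g k| ≤ M) (c : ℝ)
    (b j : ℕ) : |g (b + j) - g b - c * j| ≤ (M + |c|) * j := by
  induction j with
  | zero => simp
  | succ j ih =>
    have e : g (b + (j + 1)) - g b - c * ((j + 1 : ℕ) : ℝ) =
        (g (b + j) - g b - c * j) + ((g (b + j + 1) - g (b + j)) - c) := by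
      push_cast; rw [← add_assoc]; ring
    rw [e]
    refine (abs_add_le _ _).trans ?_
    have := (abs_sub (g (b + j + 1) - g (b + j)) c).trans (add_le_add_left (hg (b + j)) _)
    push_cast
    linarith

lemma abs_sub_le_mul_abs_sub {g : ℕ → ℝ} {M : ℝ} (hg : ∀ k, |g (k + 1) - g k| ≤ M) (a b : ℕ) :
    |g a - g b| ≤ M * |(a : ℝ) - b| := by
  wlog h : b ≤ a generalizing a b
  · rw [abs_sub_comm, abs_sub_comm (a : ℝ)]
    exact this b a (le_of_not_ge h)
  obtain ⟨j, rfl⟩ := Nat.exists_eq_add_of_le h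
  simpa using abs_add_sub_sub_mul_le hg 0 b j

/-- The remainder of the first-order expansion of `g` at `a`. It vanishes when `b - a` is zero or
one, which is why the bound involves `(b - a) (b - a - 1)` instead of `(b - a)²`. -/
lemma abs_taylor_le {g : ℕ → ℝ} {M : ℝ} (hg : ∀ k, |g (k + 1) - g k| ≤ M) (a b : ℕ) :
    |g b - g a - (g (a + 1) - g a) * ((b : ℝ) - a)| ≤
      M * (((b : ℝ) - a) * ((b : ℝ) - a - 1)) := by
  have hM : 0 ≤ M := (abs_nonneg _).trans (hg 0)
  have hΔ := hg a
  rcases le_total b a with h | h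
  · obtain ⟨j, rfl⟩ := Nat.exists_eq_add_of_le h
    have key := abs_add_sub_sub_mul_le hg (g (b + j + 1) - g (b + j)) b j
    rw [← abs_neg]
    push_cast
    have e : -(g b - g (b + j) - (g (b + j + 1) - g (b + j)) * ((b : ℝ) - (b + j))) =
      g (b + j) - g b - (g (b + j + 1) - g (b + j)) * j := by ring
    rw [e]
    refine key.trans ?_
    rcases Nat.eq_zero_or_pos j with rfl | hj
    · simp
    · have h1 : (1 : ℝ) ≤ j := by exact_mod_cast hj
      have h2 : (M + |g (b + j + 1) - g (b + j)|) * j ≤ (M + M) * j := by gcongr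
      nlinarith [mul_nonneg hM (mul_nonneg (zero_le_one.trans h1) (sub_nonneg.2 h1))]
  · obtain ⟨j, rfl⟩ := Nat.exists_eq_add_of_le h
    rcases Nat.eq_zero_or_pos j with rfl | hj
    · simp
    · obtain ⟨i, rfl⟩ := Nat.exists_eq_add_of_le' hj
      -- the first step is expanded exactly
      have key := abs_add_sub_sub_mul_le hg (g (a + 1) - g a) (a + 1) i
      have e : g (a + (i + 1)) - g a -
          (g (a + 1) - g a) * (((a + (i + 1) : ℕ) : ℝ) - a) =
          g (a + 1 + i) - g (a + 1) - (g (a + 1) - g a) * i := by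
        rw [show a + (i + 1) = a + 1 + i by ring]; push_cast; ring
      rw [e]
      refine key.trans ?_
      have h2 : (M + |g (a + 1) - g a|) * i ≤ (M + M) * i := by gcongr
      push_cast
      rcases Nat.eq_zero_or_pos i with rfl | hi
      · simp
      · have h1 : (1 : ℝ) ≤ i := by exact_mod_cast hi
        nlinarith [mul_nonneg hM (mul_nonneg (zero_le_one.trans h1) (sub_nonneg.2 h1))]

lemma abs_D_comp_le {g : ℕ → ℝ} {M : ℝ} (hg : ∀ k, |g (k + 1) - g k| ≤ M) (F : Omega → ℕ) (k : ℕ)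
    (ω : Omega) : |D p (fun ω => g (F ω)) k ω| ≤ M * |D p (fun ω => (F ω : ℝ)) k ω| := by
  simp only [D, abs_mul, abs_of_pos (sd_pos p k)]
  rw [mul_left_comm]
  exact mul_le_mul_of_nonneg_left (abs_sub_le_mul_abs_sub hg _ _) (sd_pos p k).le

/-- The approximate chain rule. -/
lemma abs_D_comp_sub_le {g : ℕ → ℝ} {M : ℝ} (hg : ∀ k, |g (k + 1) - g k| ≤ M) (F : Omega → ℕ)
    (k : ℕ) (ω : Omega) :
    |D p (fun ω => g (F ω)) k ω - (g (F ω + 1) - g (F ω)) * D p (fun ω => (F ω : ℝ)) k ω| ≤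
      M * (1 / sd p k * D p (fun ω => (F ω : ℝ)) k ω *
        (D p (fun ω => (F ω : ℝ)) k ω + sd p k * X k ω)) := by
  have hsd := sd_pos p k
  have hX : X k ω = ((ω k : ℤ) : ℝ) := rfl
  simp only [D]
  set n₁ := F (Function.update ω k 1) with h₁
  set n₂ := F (Function.update ω k (-1)) with h₂
  have e1 : sd p k * (g n₁ - g n₂) - (g (F ω + 1) - g (F ω)) * (sd p k * ((n₁ : ℝ) - n₂)) =
      sd p k * (g n₁ - g n₂ - (g (F ω + 1) - g (F ω)) * ((n₁ : ℝ) - n₂)) := by ring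
  have e2 : M * (1 / sd p k * (sd p k * ((n₁ : ℝ) - n₂)) *
      (sd p k * ((n₁ : ℝ) - n₂) + sd p k * X k ω)) =
      sd p k * (M * (((n₁ : ℝ) - n₂) * ((n₁ : ℝ) - n₂ + X k ω))) := by
    field_simp
  rw [e1, e2, abs_mul, abs_of_pos hsd]
  refine mul_le_mul_of_nonneg_left ?_ hsd.le
  rcases Int.units_eq_one_or (ω k) with h | h
  · have hF : F ω = n₁ := by rw [h₁, ← h, Function.update_eq_self]
    have key := abs_taylor_le hg n₁ n₂
    rw [hF, hX, h, ← abs_neg]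
    convert! key using 2
    · ring
    · push_cast; ring
  · have hF : F ω = n₂ := by rw [h₂, ← h, Function.update_eq_self]
    have key := abs_taylor_le hg n₂ n₁
    rw [hF, hX, h]
    convert! key using 2
    push_cast; ring

/-! ### The Chen–Stein bound -/

/-- The bound on `|P(F ∈ A) - P(Po(l) ∈ A)|` for a single set `A`. -/
lemma abs_measureReal_sub_poissonMeasure_le {F : Omega → ℕ}
    {f : (n : ℕ) → (Fin n → ℕ) → ℝ} (hF : IsChaosRep p (fun ω => (F ω : ℝ)) f)
    (hN : ∀ k, MemLp (negDLInv p (fun ω => (F ω : ℝ)) k) 2 (P p))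
    (hprod : Summable fun k => ∫ ω, ‖D p (fun ω => (F ω : ℝ)) k ω *
      negDLInv p (fun ω => (F ω : ℝ)) k ω‖ ∂(P p))
    {l : ℝ≥0} (hl : 0 < l) (A : Set ℕ) :
    ENNReal.ofReal |((P p).map F).real A - (poissonMeasure l).real A| ≤
      ENNReal.ofReal (min 1 √(2 / (Real.exp 1 * (l : ℝ))) * |(l : ℝ) - ∫ ω, (F ω : ℝ) ∂(P p)|)
      + ENNReal.ofReal ((1 - Real.exp (-(l : ℝ))) / (l : ℝ) *
          ∫ ω, |(l : ℝ) - ∑' k : ℕ,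
            D p (fun ω => (F ω : ℝ)) k ω * negDLInv p (fun ω => (F ω : ℝ)) k ω| ∂(P p))
      + ENNReal.ofReal ((1 - Real.exp (-(l : ℝ))) / (l : ℝ)) *
          ∫⁻ ω, ∑' k : ℕ, ENNReal.ofReal
            (1 / sd p k * D p (fun ω => (F ω : ℝ)) k ω *
              (D p (fun ω => (F ω : ℝ)) k ω + sd p k * X k ω) *
              |negDLInv p (fun ω => (F ω : ℝ)) k ω|) ∂(P p) := by
  have hl' : (0 : ℝ) < l := hl
  obtain ⟨g, α, hα, hstein, hg, hdiff⟩ := exists_stein_solution hl' A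
  set B := min 1 √(2 / (Real.exp 1 * (l : ℝ)))
  set M := (1 - Real.exp (-(l : ℝ))) / (l : ℝ)
  have hM : 0 ≤ M := (abs_nonneg _).trans (hdiff 0)
  set u : Omega → ℝ := fun ω => (F ω : ℝ) with hu
  set m := ∫ ω, u ω ∂(P p) with hm
  set N := negDLInv p u with hNdef
  set T : Omega → ℝ := fun ω => ∑' k, D p u k ω * N k ω with hT
  have hDu (k : ℕ) : MemLp (D p u k) 2 (P p) := memLp_D hF.memLp k
  have hFm : AEMeasurable F (P p) := by
    have := Nat.measurable_floor.comp_aemeasurable hF.memLp.aestronglyMeasurable.aemeasurable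
    simpa [Function.comp_def, hu] using this
  -- bounded functions of `F` are square-integrable
  have bdd {h : ℕ → ℝ} {C : ℝ} (hC : ∀ k, |h k| ≤ C) : MemLp (fun ω => h (F ω)) 2 (P p) :=
    MemLp.of_bound ((Measurable.of_discrete (f := h)).comp_aemeasurable hFm).aestronglyMeasurable C
      (Filter.Eventually.of_forall fun ω => hC _)
  set v : Omega → ℝ := fun ω => g (F ω) with hv
  set Δ : Omega → ℝ := fun ω => g (F ω + 1) - g (F ω) with hΔ
  have hvL : MemLp v 2 (P p) := bdd hg
  have hΔL : MemLp Δ 2 (P p) := bdd hdiff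
  obtain ⟨hTs, hTi⟩ := ae_summable_and_integrable_tsum
    (fun k => (hDu k).integrable_mul (hN k)) hprod
  -- the products `D_k g(F) · (-D_k L⁻¹ F)` are dominated by multiples of `D_k F · (-D_k L⁻¹ F)`
  have hDv : Summable fun k => ∫ ω, ‖N k ω * D p v k ω‖ ∂(P p) := by
    refine Summable.of_nonneg_of_le (fun k => integral_nonneg fun ω => norm_nonneg _)
      (fun k => ?_) (hprod.mul_left M)
    rw [← integral_const_mul]
    refine integral_mono ((hN k).integrable_mul (memLp_D hvL k)).norm
      (((hDu k).integrable_mul (hN k)).norm.const_mul M) fun ω => ?_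
    dsimp only
    rw [norm_mul, norm_mul, mul_comm, ← mul_assoc]
    exact mul_le_mul_of_nonneg_right (abs_D_comp_le hdiff F k ω) (norm_nonneg _)
  have hDvi (k : ℕ) : Integrable (fun ω => N k ω * D p v k ω) (P p) :=
    (hN k).integrable_mul (memLp_D hvL k)
  obtain ⟨hVs, hVi⟩ := ae_summable_and_integrable_tsum hDvi hDv
  -- integration by parts
  have hibp : ∫ ω, (u ω - m) * v ω ∂(P p) = ∫ ω, ∑' k, N k ω * D p v k ω ∂(P p) := by
    have hc := hF.centered
    have h0 : ∫ ω, (u ω - m) ∂(P p) = 0 := by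
      rw [integral_sub (hF.memLp.integrable one_le_two) (integrable_const _)]
      simp [hm]
    exact (hc.hasSum_integral_neg_D_LInv_mul_D h0 hvL).unique
      (hasSum_integral_of_summable_integral_norm hDvi hDv)
  set R : Omega → ℝ := fun ω => ∑' k, N k ω * (D p v k ω - Δ ω * D p u k ω) with hR
  have hsplit : ∀ᵐ ω ∂(P p), ∑' k, N k ω * D p v k ω = Δ ω * T ω + R ω := by
    filter_upwards [hTs, hVs] with ω h1 h2
    have h3 : Summable fun k => Δ ω * (D p u k ω * N k ω) := h1.mul_left (Δ ω)
    rw [hT, hR]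
    dsimp only
    have e (k : ℕ) : N k ω * (D p v k ω - Δ ω * D p u k ω) =
        N k ω * D p v k ω - Δ ω * (D p u k ω * N k ω) := by ring
    simp only [e]
    rw [h2.tsum_sub h3, tsum_mul_left]
    ring
  have hΔT : Integrable (fun ω => Δ ω * T ω) (P p) :=
    hTi.bdd_mul (c := M) hΔL.aestronglyMeasurable (Filter.Eventually.of_forall fun ω => hdiff _)
  have hRi : Integrable R (P p) := by
    refine (hVi.sub hΔT).congr ?_
    filter_upwards [hsplit] with ω hω
    rw [Pi.sub_apply, hω]; ring
  have hvi := hvL.integrable one_le_two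
  have hΔi := hΔL.integrable one_le_two
  have hδ : Integrable (fun ω => Δ ω * ((l : ℝ) - T ω)) (P p) := by
    refine ((hΔi.mul_const (l : ℝ)).sub hΔT).congr (Filter.Eventually.of_forall fun ω => ?_)
    simp only [Pi.sub_apply]; ring
  have huv : Integrable (fun ω => (u ω - m) * v ω) (P p) :=
    (hF.memLp.sub (memLp_const m)).integrable_mul hvL
  -- the Stein identity
  have hmain : ((P p).map F).real A - (poissonMeasure l).real A =
      ((l : ℝ) - m) * ∫ ω, v ω ∂(P p) + ∫ ω, Δ ω * ((l : ℝ) - T ω) ∂(P p) - ∫ ω, R ω ∂(P p) := by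
    have e1 : ((P p).map F).real A = ∫ ω, A.indicator (1 : ℕ → ℝ) (F ω) ∂(P p) := by
      rw [← integral_indicator_one (MeasurableSet.of_discrete (s := A)),
        integral_map hFm Measurable.of_discrete.aestronglyMeasurable]
    have hind : Integrable (fun ω => A.indicator (1 : ℕ → ℝ) (F ω)) (P p) :=
      (bdd (C := 1) fun k => by by_cases h : k ∈ A <;> simp [h]).integrable one_le_two
    have e2 : ∫ ω, (A.indicator (1 : ℕ → ℝ) (F ω) - α) ∂(P p) =
        ((P p).map F).real A - α := by
      rw [integral_sub hind (integrable_const _), ← e1]; simp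
    rw [poissonMeasure_real_eq hα, ← e2]
    have e3 (ω : Omega) : A.indicator (1 : ℕ → ℝ) (F ω) - α =
        (l : ℝ) * Δ ω + ((l : ℝ) - m) * v ω - (u ω - m) * v ω := by
      rw [← hstein]; simp only [hΔ, hv, hu]; ring
    simp only [e3]
    have hsum : Integrable (fun ω => (l : ℝ) * Δ ω + ((l : ℝ) - m) * v ω) (P p) :=
      (hΔi.const_mul _).add (hvi.const_mul _)
    rw [integral_sub hsum huv,
      integral_add (hΔi.const_mul _) (hvi.const_mul _), integral_const_mul, integral_const_mul,
      hibp, integral_congr_ae hsplit, integral_add hΔT hRi]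
    have e4 : ∫ ω, Δ ω * ((l : ℝ) - T ω) ∂(P p) =
        (l : ℝ) * ∫ ω, Δ ω ∂(P p) - ∫ ω, Δ ω * T ω ∂(P p) := by
      rw [← integral_const_mul, ← integral_sub (hΔi.const_mul _) hΔT]
      congr 1; ext ω; ring
    rw [e4]; ring
  rw [hmain]
  have t1 : |((l : ℝ) - m) * ∫ ω, v ω ∂(P p)| ≤ B * |(l : ℝ) - m| := by
    rw [abs_mul, mul_comm]
    refine mul_le_mul_of_nonneg_right ?_ (abs_nonneg _)
    have := norm_integral_le_of_norm_le_const (μ := P p) (f := v) (C := B)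
      (Filter.Eventually.of_forall fun ω => hg _)
    simpa using this
  have t2 : |∫ ω, Δ ω * ((l : ℝ) - T ω) ∂(P p)| ≤ M * ∫ ω, |(l : ℝ) - T ω| ∂(P p) := by
    refine (abs_integral_le_integral_abs).trans ?_
    rw [← integral_const_mul]
    refine integral_mono hδ.abs (((integrable_const _).sub hTi).abs.const_mul M) fun ω => ?_
    dsimp only
    rw [abs_mul]
    exact mul_le_mul_of_nonneg_right (hdiff _) (abs_nonneg _)
  have t3 : ENNReal.ofReal |∫ ω, R ω ∂(P p)| ≤ ENNReal.ofReal M * ∫⁻ ω, ∑' k : ℕ, ENNReal.ofReal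
      (1 / sd p k * D p u k ω * (D p u k ω + sd p k * X k ω) * |N k ω|) ∂(P p) := by
    rw [← Real.norm_eq_abs, ofReal_norm]
    refine (enorm_integral_le_lintegral_enorm _).trans ?_
    rw [← lintegral_const_mul' _ _ ENNReal.ofReal_ne_top]
    refine lintegral_mono fun ω => ?_
    refine enorm_tsum_le_tsum_enorm.trans ?_
    rw [← ENNReal.tsum_mul_left]
    refine ENNReal.tsum_le_tsum fun k => ?_
    rw [← ENNReal.ofReal_mul hM, ← ofReal_norm]
    refine ENNReal.ofReal_le_ofReal ?_
    rw [norm_mul, mul_comm, ← mul_assoc]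
    exact mul_le_mul_of_nonneg_right (abs_D_comp_sub_le hdiff F k ω) (abs_nonneg _)
  calc _ ≤ ENNReal.ofReal (B * |(l : ℝ) - m| + M * ∫ ω, |(l : ℝ) - T ω| ∂(P p) +
        |∫ ω, R ω ∂(P p)|) := by
        refine ENNReal.ofReal_le_ofReal ((abs_sub _ _).trans ?_)
        gcongr
        exact (abs_add_le _ _).trans (add_le_add t1 t2)
    _ ≤ _ := by
        refine ENNReal.ofReal_add_le.trans ?_
        exact add_le_add ENNReal.ofReal_add_le t3

end

end RademacherPoisson

open RademacherPoisson
theorem theorem3p1 (p : ℕ → Set.Ioo (0 : ℝ) 1) (F : Omega → ℕ)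
    (hF : DomD p fun ω => (F ω : ℝ)) (l : ℝ≥0) (hl : 0 < l) :
    (∀ᵐ ω ∂(P p), Summable fun k : ℕ =>
      D p (fun ω => (F ω : ℝ)) k ω * negDLInv p (fun ω => (F ω : ℝ)) k ω) ∧
    Integrable (fun ω => ∑' k : ℕ,
      D p (fun ω => (F ω : ℝ)) k ω * negDLInv p (fun ω => (F ω : ℝ)) k ω) (P p) ∧
    ENNReal.ofReal (dTV ((P p).map F) (poissonMeasure l)) ≤
      ENNReal.ofReal (min 1 √(2 / (Real.exp 1 * (l : ℝ))) * |(l : ℝ) - ∫ ω, (F ω : ℝ) ∂(P p)|)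
      + ENNReal.ofReal ((1 - Real.exp (-(l : ℝ))) / (l : ℝ) *
          ∫ ω, |(l : ℝ) - ∑' k : ℕ,
            D p (fun ω => (F ω : ℝ)) k ω * negDLInv p (fun ω => (F ω : ℝ)) k ω| ∂(P p))
      + ENNReal.ofReal ((1 - Real.exp (-(l : ℝ))) / (l : ℝ)) *
          ∫⁻ ω, ∑' k : ℕ, ENNReal.ofReal
            (1 / sd p k * D p (fun ω => (F ω : ℝ)) k ω *
              (D p (fun ω => (F ω : ℝ)) k ω + sd p k * X k ω) *
              |negDLInv p (fun ω => (F ω : ℝ)) k ω|) ∂(P p) := by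
  obtain ⟨f, hf, hD⟩ := hF
  have hN (k : ℕ) : MemLp (negDLInv p (fun ω => (F ω : ℝ)) k) 2 (P p) :=
    (memLp_D (Lp.memLp _) k).neg
  have hprod := summable_integral_norm_mul (fun k => memLp_D hf.memLp k) hN
    (hf.summable_integral_sq_D hD)
    (by simpa only [negDLInv, neg_sq] using hf.centered.summable_integral_sq_D_LInv)
  obtain ⟨h1, h2⟩ := ae_summable_and_integrable_tsum
    (fun k => (memLp_D hf.memLp k).integrable_mul (hN k)) hprod
  refine ⟨h1, h2, ?_⟩
  have hA := abs_measureReal_sub_poissonMeasure_le hf hN hprod hl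
  -- the right-hand side may be infinite, in which case there is nothing to show
  by_cases htop : ENNReal.ofReal (min 1 √(2 / (Real.exp 1 * (l : ℝ))) *
        |(l : ℝ) - ∫ ω, (F ω : ℝ) ∂(P p)|)
      + ENNReal.ofReal ((1 - Real.exp (-(l : ℝ))) / (l : ℝ) *
          ∫ ω, |(l : ℝ) - ∑' k : ℕ,
            D p (fun ω => (F ω : ℝ)) k ω * negDLInv p (fun ω => (F ω : ℝ)) k ω| ∂(P p))
      + ENNReal.ofReal ((1 - Real.exp (-(l : ℝ))) / (l : ℝ)) *
          ∫⁻ ω, ∑' k : ℕ, ENNReal.ofReal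
            (1 / sd p k * D p (fun ω => (F ω : ℝ)) k ω *
              (D p (fun ω => (F ω : ℝ)) k ω + sd p k * X k ω) *
              |negDLInv p (fun ω => (F ω : ℝ)) k ω|) ∂(P p) = ∞
  · rw [htop]; exact le_top
  · exact ENNReal.ofReal_le_of_le_toReal
      (ciSup_le fun A => (ENNReal.ofReal_le_iff_le_toReal htop).mp (hA A))
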